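/- **Setting.** Let $\mathcal E_0$ be a real Hilbert space (for instance $L^2(\mathbb R,dt)$) with an orthonormal basis $\{e_j\}_{j\ge 0}$, and let $A$ be the positive self-adjoint operator in $\mathcal E_0$ with $Ae_j=\lambda_je_j$, $\lambda_j>0$, where $\sum_j\lambda_j^{-2s}<\infty$ for some $s>0$. Put $|f|_p=|A^pf|_0$, let $\mathcal E_p$ be the domain of $A^p$, and let $\mathcal E=\bigcap_{p\ge0}\mathcal E_p$ with the projective limit topology. Let $\mathcal E'_c$ be the complexification of the dual of $\mathcal E$ (with the strong topology), $|\xi|_{-p}^2=|A^{-p}\xi|_0^2=\sum_j\lambda_j^{-2p}|\langle\xi,e_j\rangle|^2$ for $\xi\in\mathcal E'_c$, and $\mathcal E'_{p,c}=\{\xi\in\mathcal E'_c:|\xi|_{-p}<\infty\}$. For real $q<p$ let $\|i_{p,q}\|_{HS}^2=\sum_j\lambda_j^{-2(p-q)}\in[0,\infty]$ be the squared Hilbert–Schmidt norm of the inclusion $\mathcal E_p\to\mathcal E_q$. Let $\mathcal E_c^{\widehat\otimes(l+m)}$ be the space of those elements of the completed $(l+m)$-fold tensor power of $\mathcal E_c$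 (the projective limit over $p\ge 0$ of the Hilbert space tensor powers $\mathcal E_{p,c}^{\otimes(l+m)}$) that are symmetric in the first $l$ and in the last $m$ variables separately, and put $|\kappa|_{q_1,q_2}=|(A^{q_1})^{\otimes l}\otimes(A^{q_2})^{\otimes m}\kappa|_0$ for $q_1,q_2\in\mathbb R$. A function on $\mathcal E'_c\times\mathcal E'_c$ is called entire if it is continuous and its restriction to every complex line is holomorphic. Let $C_{+,\log}$ be the set of positive continuous functions $u$ on $[0,\infty)$ with $\lim_{r\to\infty}\log u(r)/\log r=\infty$, and for $u\in C_{+,\log}$ put $\ell_u(t)=\inf_{r>0}u(r)/r^t$, $t\ge0$. **Lemma.** Let $u_1,u_2\in C_{+,\log}$ and let $F$ be an entire function on $\mathcal E'_c\times\mathcal E'_c$. Then there exist kernels $\kappa_{l,m}\in\mathcal E_c^{\widehat\otimes(l+m)}$ ($l,m\ge0$) such that $$F(\xi,\eta)=\sum_{l,m=0}^\infty\langle\kappa_{l,m},\xi^{\otimes l}\otimes\eta^{\otimes m}\rangle\qquad(\xi,\eta\in\mathcal E'_c),$$ where the double series, and for all $l,m$ the series over the product basis $e_{j_1}\otimes\cdots\otimes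 e_{j_{l+m}}$ that expresses the bilinear pairing, converge absolutely, and such that the following holds for all $C>0$, $K_1,K_2>0$ and $p_1,p_2\ge0$: if $$|F(\xi,\eta)|^2\le C\,u_1(K_1|\xi|_{-p_1}^2)\,u_2(K_2|\eta|_{-p_2}^2)\qquad\text{for all }\xi\in\mathcal E'_{p_1,c},\ \eta\in\mathcal E'_{p_2,c},$$ then $$|\kappa_{l,m}|^2_{q_1,q_2}\le C\,(K_1e^2\|i_{p_1,q_1}\|_{HS}^2)^l\,(K_2e^2\|i_{p_2,q_2}\|_{HS}^2)^m\,\ell_{u_1}(l)\,\ell_{u_2}(m)\qquad(l,m\ge0)$$ for all real $q_1<p_1$, $q_2<p_2$ with $K_ie^2\|i_{p_i,q_i}\|_{HS}^2<1$ ($i=1,2$). -/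

import Mathlib

open scoped NNReal ENNReal

noncomputable section

namespace WhiteNoise

/-- The data from which the Gel'fand triple `E ⊂ E₀ ⊂ E'` is built: a real Hilbert space `H = E₀`
(for instance `L²(ℝ, dt)`) and a positive self-adjoint operator `A` in it, given by its spectral
resolution: an orthonormal basis `e₀, e₁, …` of `H` with `A e_j = λ_j e_j` and `λ_j > 0`.
The last field says that some negative power of `A` is Hilbert-Schmidt, which is what makes
the space `E` nuclear. -/
structure GelfandData (H : Type*) [NormedAddCommGroup H] [InnerProductSpace ℝ H] where
  /-- the orthonormal basis `e_j` of eigenvectors -/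
  basis : HilbertBasis ℕ ℝ H
  /-- the eigenvalues `λ_j` -/
  eig : ℕ → ℝ
  eig_pos : ∀ j, 0 < eig j
  nuclear : ∃ s : ℝ, 0 < s ∧ Summable fun j => eig j ^ (-(2 * s))

variable {H : Type*} [NormedAddCommGroup H] [InnerProductSpace ℝ H] (D : GelfandData H)

/-- The subspace `E = ⋂_{p ≥ 0} E_p` of `H`, where `E_p` is the domain of `A^p`, that is, the set
of all `f` for which `|f|_p² = ∑ λ_j^{2p} ⟨e_j, f⟩²` is finite. -/
def testSubmodule : Submodule ℝ H where
  carrier := {f | ∀ p : ℝ≥0, Memℓp (fun j : ℕ => D.eig j ^ (p : ℝ) * D.basis.repr f j) 2}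
  zero_mem' := by
    intro p
    have h : (fun j : ℕ => D.eig j ^ (p : ℝ) * D.basis.repr (0 : H) j) = (0 : ℕ → ℝ) := by
      funext j; simp
    rw [h]; exact zero_memℓp
  add_mem' := by
    intro f g hf hg p
    have h : (fun j : ℕ => D.eig j ^ (p : ℝ) * D.basis.repr (f + g) j)
        = (fun j : ℕ => D.eig j ^ (p : ℝ) * D.basis.repr f j)
          + (fun j : ℕ => D.eig j ^ (p : ℝ) * D.basis.repr g j) := by
      funext j; simp [mul_add]
    rw [h]; exact (hf p).add (hg p)
  smul_mem' := by
    intro c f hf p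
    have h : (fun j : ℕ => D.eig j ^ (p : ℝ) * D.basis.repr (c • f) j)
        = c • (fun j : ℕ => D.eig j ^ (p : ℝ) * D.basis.repr f j) := by
      funext j; simp [mul_left_comm]
    rw [h]; exact (hf p).const_smul c

/-- The space `E` as a type of its own (its topology is not the one induced by `H`). -/
def TestSpace : Type _ := testSubmodule D

instance : AddCommGroup (TestSpace D) := inferInstanceAs (AddCommGroup (testSubmodule D))

instance : Module ℝ (TestSpace D) := inferInstanceAs (Module ℝ (testSubmodule D))

/-- The operator `A^p : E → H`, `f ↦ ∑ λ_j^p ⟨e_j, f⟩ e_j`. -/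
def opPow (p : ℝ≥0) : TestSpace D →ₗ[ℝ] H where
  toFun f := D.basis.repr.symm ⟨fun j : ℕ => D.eig j ^ (p : ℝ) * D.basis.repr f.1 j, f.2 p⟩
  map_add' f g := by
    rw [← map_add]
    congr 1
    ext j
    change D.eig j ^ (p : ℝ) * D.basis.repr (f.1 + g.1) j = _
    simp [mul_add]
    rfl
  map_smul' c f := by
    rw [← map_smul]
    congr 1
    ext j
    change D.eig j ^ (p : ℝ) * D.basis.repr (c • f.1) j = _
    simp [mul_left_comm]

/-- The topology of `E` is the projective limit topology, generated by all the norms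
`|f|_p = |A^p f|₀`, `p ≥ 0`. -/
instance : TopologicalSpace (TestSpace D) :=
  ⨅ p : ℝ≥0, TopologicalSpace.induced (opPow D p) inferInstance

instance : IsTopologicalAddGroup (TestSpace D) :=
  topologicalAddGroup_iInf fun p => topologicalAddGroup_induced (opPow D p)

instance : ContinuousSMul ℝ (TestSpace D) :=
  continuousSMul_iInf fun p => continuousSMul_induced (opPow D p)

/-- The basis vector `e_j`, as an element of `E`. -/
def basisVec (j : ℕ) : TestSpace D :=
  ⟨D.basis j, by
    intro p
    have h : (fun i : ℕ => D.eig i ^ (p : ℝ) * D.basis.repr (D.basis j) i)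
        = ((D.eig j ^ (p : ℝ)) • lp.single (E := fun _ : ℕ => ℝ) 2 j (1 : ℝ) :
            lp (fun _ : ℕ => ℝ) 2) := by
      funext i
      rw [D.basis.repr_self]
      by_cases hij : i = j
      · subst hij; simp
      · simp [lp.coeFn_single, hij]
    rw [h]
    exact lp.memℓp _⟩

/-- The complexified dual space `E'_c = E' + iE'`: the continuous real-linear maps `E → ℂ`. It is a
complex vector space, and carries the strong topology (uniform convergence on bounded sets). -/
abbrev DualC : Type _ := TestSpace D →L[ℝ] ℂ

/-- `|ξ|²_{-p} = |A^{-p} ξ|₀² = ∑ λ_j^{-2p} |⟨ξ, e_j⟩|²`, an extended number;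
it is finite exactly on `E'_{p,c}`. -/
def dualNormSq (p : ℝ) (ξ : DualC D) : ℝ≥0∞ :=
  ∑' j : ℕ, ENNReal.ofReal (D.eig j ^ (-(2 * p)) * ‖ξ (basisVec D j)‖ ^ 2)

/-- The square `‖i_{p,q}‖²_HS` of the Hilbert-Schmidt norm of the inclusion `E_p → E_q`. As the
`λ_j^{-p} e_j` form an orthonormal basis of `E_p`, it is `∑ |λ_j^{-p} e_j|_q² = ∑ λ_j^{-2(p-q)}`. -/
def hsNormSq (p q : ℝ) : ℝ≥0∞ :=
  ∑' j : ℕ, ENNReal.ofReal (D.eig j ^ (-(2 * (p - q))))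

/-- `|κ|²_{q₁,q₂} = |(A^{q₁})^{⊗l} ⊗ (A^{q₂})^{⊗m} κ|₀²` for
`κ = ∑ κ_{j,k} e_{j 1} ⊗ ⋯ ⊗ e_{j l} ⊗ e_{k 1} ⊗ ⋯ ⊗ e_{k m}`, given by its coefficients with
respect to the orthonormal product basis of the Hilbert space tensor power `H_c^{⊗(l+m)}`. -/
def tensorNormSq {l m : ℕ} (q₁ q₂ : ℝ) (κ : (Fin l → ℕ) → (Fin m → ℕ) → ℂ) : ℝ≥0∞ :=
  ∑' jk : (Fin l → ℕ) × (Fin m → ℕ),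
    ENNReal.ofReal ((∏ a, D.eig (jk.1 a) ^ (2 * q₁)) * (∏ b, D.eig (jk.2 b) ^ (2 * q₂))
      * ‖κ jk.1 jk.2‖ ^ 2)

/-- The space of kernels `E_c^{⊗̂(l+m)}`: the elements of the completed tensor power of `E_c`, the
projective limit over `p ≥ 0` of the Hilbert space tensor powers `E_{p,c}^{⊗(l+m)}`, that are
symmetric in the first `l` and in the last `m` variables separately. An element is given by its
coefficients with respect to `e_{j 1} ⊗ ⋯ ⊗ e_{j l} ⊗ e_{k 1} ⊗ ⋯ ⊗ e_{k m}`. -/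
structure TensorKernel (l m : ℕ) where
  coeff : (Fin l → ℕ) → (Fin m → ℕ) → ℂ
  norm_finite : ∀ p : ℝ, 0 ≤ p → tensorNormSq D p p coeff < ∞
  symm : ∀ (σ : Equiv.Perm (Fin l)) (τ : Equiv.Perm (Fin m)) (j : Fin l → ℕ) (k : Fin m → ℕ),
    coeff (j ∘ σ) (k ∘ τ) = coeff j k

variable {D}

/-- The terms of the (bilinear) pairing `⟨κ, ξ^{⊗l} ⊗ η^{⊗m}⟩`. -/
def TensorKernel.pairingTerm {l m : ℕ} (κ : TensorKernel D l m) (ξ η : DualC D)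
    (jk : (Fin l → ℕ) × (Fin m → ℕ)) : ℂ :=
  κ.coeff jk.1 jk.2 * (∏ a, ξ (basisVec D (jk.1 a))) * (∏ b, η (basisVec D (jk.2 b)))

/-- The canonical bilinear pairing `⟨κ, ξ^{⊗l} ⊗ η^{⊗m}⟩`. -/
def TensorKernel.pairing {l m : ℕ} (κ : TensorKernel D l m) (ξ η : DualC D) : ℂ :=
  ∑' jk, κ.pairingTerm ξ η jk

/-- Entire functions on `E'_c × E'_c`: continuous, and holomorphic on every complex line. -/
def IsEntire (F : DualC D × DualC D → ℂ) : Prop :=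
  Continuous F ∧ ∀ x y : DualC D × DualC D, Differentiable ℂ fun z : ℂ => F (x + z • y)

/-- The class `C_{+,log}` of positive continuous functions `u` on `[0, ∞)` with
`log u(r) / log r → ∞` as `r → ∞`. -/
structure MemCLog (u : ℝ → ℝ) : Prop where
  continuousOn : ContinuousOn u (Set.Ici 0)
  pos : ∀ r, 0 ≤ r → 0 < u r
  tendsto : Filter.Tendsto (fun r => Real.log (u r) / Real.log r) Filter.atTop Filter.atTop

/-- The Legendre transform `ℓ_u(t) = inf_{r > 0} u(r) / r^t`. -/
def legendre (u : ℝ → ℝ) (t : ℝ) : ℝ :=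
  ⨅ r : Set.Ioi (0 : ℝ), u r / (r : ℝ) ^ t

/-- `|F(ξ,η)|² ≤ C u₁(K₁|ξ|²_{-p₁}) u₂(K₂|η|²_{-p₂})` for all `ξ ∈ E'_{p₁,c}`, `η ∈ E'_{p₂,c}`
(elsewhere the right hand side is infinite). -/
def GrowthBound (u₁ u₂ : ℝ → ℝ) (F : DualC D × DualC D → ℂ) (C K₁ K₂ p₁ p₂ : ℝ) : Prop :=
  ∀ ξ η : DualC D, dualNormSq D p₁ ξ < ∞ → dualNormSq D p₂ η < ∞ →
    ‖F (ξ, η)‖ ^ 2 ≤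
      C * u₁ (K₁ * (dualNormSq D p₁ ξ).toReal) * u₂ (K₂ * (dualNormSq D p₂ η).toReal)

end WhiteNoise

end

/-! The kernels are the Taylor coefficients of `F` at the origin along the coordinate functionals:
`κ_{j,k}` is `1/(l! m!)` times the mixed derivative in the directions `j₁, …, j_l` of the first
variable and `k₁, …, k_m` of the second. They do not involve the growth bound, so one family serves
all constants at once.

Size: Cauchy's estimate is applied on a torus with weighted radius `r/l` in each of the `l`
directions. A sum of `l` vectors of norm at most `r/l` stays in the ball of radius `r`, and the
price `l^l/l! ≤ e^l` becomes `e²` per index after squaring. With `K r² = ρ` the growth bound gives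
`|κ_{j,k}|²` at most `C (K₁e²)^l (K₂e²)^m ∏ λ_{j_a}^{-2p₁} ∏ λ_{k_b}^{-2p₂}` times `u₁(ρ₁)/ρ₁^l ·
u₂(ρ₂)/ρ₂^m` (`GrowthBound.norm_taylorCoeff_sq_le_of_pos`). Infima over `ρ₁, ρ₂` produce the
Legendre transforms, and summation against the weights `λ^{2q}` produces powers of the
Hilbert-Schmidt norms (`tensorNormSq_le`).

Convergence: the coordinates of a dual element are `O(λ_j^p)` for some `p`, so they lie in a
polydisc, which is compact in the product topology. By nuclearity the map from coordinates to the
strong dual is continuous there (`continuous_synthesis`), hence `F` is bounded on polydiscs, and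
Cauchy's estimate with a large enough radius gives absolute convergence
(`IsEntire.summable_taylorTerm`). On truncated sequences the sum is a finite-dimensional Taylor
expansion; dominated convergence and continuity of `F` pass to the limit
(`IsEntire.hasSum_taylorTerm`). -/

noncomputable section

/-! ### Directional derivatives of functions holomorphic on complex lines. -/

open Complex MeasureTheory Filter Topology in
/-- A holomorphic function on the plane, expressed through its mean against `e^{-iθ}`. -/
theorem Complex.deriv_eq_integral_circleMap {g : ℂ → ℂ} (hg : Differentiable ℂ g) :
    deriv g 0 = (2 * Real.pi : ℂ)⁻¹ *
      ∫ θ in (0 : ℝ)..2 * Real.pi, (circleMap 0 1 θ)⁻¹ * g (circleMap 0 1 θ) := by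
  have h := DiffContOnCl.deriv_eq_smul_circleIntegral (c := 0) (R := 1) one_pos
    (f := g) hg.diffContOnCl
  have hpi : (Real.pi : ℂ) ≠ 0 := by exact_mod_cast Real.pi_ne_zero
  have h2 : (∮ z in C((0 : ℂ), 1), (1 / (z - 0) ^ 2) • g z)
      = I * ∫ θ in (0 : ℝ)..2 * Real.pi, (circleMap 0 1 θ)⁻¹ * g (circleMap 0 1 θ) := by
    rw [circleIntegral, ← intervalIntegral.integral_const_mul]
    refine intervalIntegral.integral_congr fun θ _ => ?_
    have hc : circleMap 0 1 θ ≠ 0 := circleMap_ne_center one_ne_zero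
    simp only [deriv_circleMap, smul_eq_mul, sub_zero]
    field_simp
  rw [h2] at h
  have h3 := mul_left_cancel₀ I_ne_zero
    (show I * (∫ θ in (0 : ℝ)..2 * Real.pi, (circleMap 0 1 θ)⁻¹ * g (circleMap 0 1 θ))
      = I * (2 * Real.pi * deriv g 0) by rw [h, smul_eq_mul]; ring)
  rw [h3]
  field_simp

/-- A function on a complex vector space that is continuous on finite-dimensional affine subspaces
and holomorphic on complex lines. -/
structure FinitelyEntire {V : Type*} [AddCommGroup V] [Module ℂ V] (f : V → ℂ) : Prop where
  continuous : ∀ (n : ℕ) (x : V) (v : Fin n → V),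
    Continuous fun z : Fin n → ℂ => f (x + ∑ i, z i • v i)
  differentiable : ∀ x v : V, Differentiable ℂ fun t : ℂ => f (x + t • v)

section

variable {V : Type*} [AddCommGroup V] [Module ℂ V]

/-- The derivative of `f` in the direction `v`. -/
def dirDeriv (v : V) (f : V → ℂ) (x : V) : ℂ := deriv (fun t : ℂ => f (x + t • v)) 0

theorem deriv_line_eq_dirDeriv (f : V → ℂ) (x v : V) (t : ℂ) :
    deriv (fun s : ℂ => f (x + s • v)) t = dirDeriv v f (x + t • v) := by
  have h : (fun s : ℂ => f (x + t • v + s • v)) = fun s => f (x + (t + s) • v) := by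
    funext s; rw [add_smul, add_assoc]
  rw [dirDeriv, h, deriv_comp_const_add (fun s => f (x + s • v))]
  simp

namespace FinitelyEntire

variable {f : V → ℂ} (hf : FinitelyEntire f)
include hf

theorem continuous_snoc {n : ℕ} (x : V) (v : Fin n → V) (u : V) :
    Continuous fun p : (Fin n → ℂ) × ℂ => f (x + ∑ i, p.1 i • v i + p.2 • u) := by
  have h := (hf.continuous (n + 1) x (Fin.snoc (α := fun _ => V) v u)).comp
    (f := fun p : (Fin n → ℂ) × ℂ => (Fin.snoc (α := fun _ => ℂ) p.1 p.2 : Fin (n + 1) → ℂ))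
    (Continuous.finSnoc continuous_fst continuous_snd)
  refine h.congr fun p => ?_
  simp [Fin.sum_univ_castSucc, add_assoc]

theorem continuous_two (x v w : V) :
    Continuous fun p : ℂ × ℂ => f (x + p.1 • v + p.2 • w) := by
  have h := (hf.continuous_snoc x (fun _ : Fin 1 => v) w).comp
    (f := fun p : ℂ × ℂ => ((fun _ => p.1 : Fin 1 → ℂ), p.2)) (by fun_prop)
  refine h.congr fun p => ?_
  simp

/-- Writing the derivative as an integral of `f` lets continuity and differentiability in further
variables pass under the integral sign. -/
theorem dirDeriv_eq_integral (v x : V) :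
    dirDeriv v f x = (2 * Real.pi : ℂ)⁻¹ * ∫ θ in (0 : ℝ)..2 * Real.pi,
      (circleMap 0 1 θ)⁻¹ * f (x + circleMap 0 1 θ • v) :=
  Complex.deriv_eq_integral_circleMap (hf.differentiable x v)

theorem hasDerivAt_line (x v : V) (t : ℂ) :
    HasDerivAt (fun s : ℂ => f (x + s • v)) (dirDeriv v f (x + t • v)) t := by
  rw [← deriv_line_eq_dirDeriv]
  exact (hf.differentiable x v t).hasDerivAt

theorem continuous_dirDeriv (u : V) (n : ℕ) (x : V) (v : Fin n → V) :
    Continuous fun z : Fin n → ℂ => dirDeriv u f (x + ∑ i, z i • v i) := by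
  simp_rw [hf.dirDeriv_eq_integral]
  refine continuous_const.mul
    (intervalIntegral.continuous_parametric_intervalIntegral_of_continuous' ?_ _ _)
  have hc : Continuous fun p : (Fin n → ℂ) × ℝ => (circleMap 0 1 p.2)⁻¹ :=
    ((continuous_circleMap 0 1).comp continuous_snd).inv₀ fun p =>
      circleMap_ne_center one_ne_zero
  exact hc.mul ((hf.continuous_snoc x v u).comp
    (f := fun p : (Fin n → ℂ) × ℝ => (p.1, circleMap 0 1 p.2))
    (continuous_fst.prodMk ((continuous_circleMap 0 1).comp continuous_snd)))

theorem continuous_two_dirDeriv (u x v w : V) :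
    Continuous fun p : ℂ × ℂ => dirDeriv u f (x + p.1 • v + p.2 • w) := by
  have h := (hf.continuous_dirDeriv u 2 x ![v, w]).comp
    (f := fun p : ℂ × ℂ => ![p.1, p.2]) (by fun_prop)
  refine h.congr fun p => ?_
  simp [Fin.sum_univ_two, add_assoc]

/-- Differentiation under the Cauchy integral. The result is again a Cauchy integral, that of the
derivative along `v` of the derivative along `w`, which is why mixed derivatives commute. -/
theorem hasDerivAt_dirDeriv (v x w : V) (t : ℂ) :
    HasDerivAt (fun s : ℂ => dirDeriv v f (x + s • w))
      ((2 * Real.pi : ℂ)⁻¹ * ∫ θ in (0 : ℝ)..2 * Real.pi,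
        (circleMap 0 1 θ)⁻¹ * dirDeriv w f (x + t • w + circleMap 0 1 θ • v)) t := by
  simp_rw [hf.dirDeriv_eq_integral v]
  refine HasDerivAt.const_mul _ ?_
  have hinv : Continuous fun θ : ℝ => (circleMap 0 1 θ)⁻¹ :=
    (continuous_circleMap 0 1).inv₀ fun θ => circleMap_ne_center one_ne_zero
  have hF : ∀ s : ℂ, Continuous fun θ : ℝ =>
      (circleMap 0 1 θ)⁻¹ * f (x + s • w + circleMap 0 1 θ • v) := fun s =>
    hinv.mul ((hf.continuous_two x w v).comp
      (continuous_const.prodMk (continuous_circleMap 0 1) : Continuous fun θ : ℝ => (s, _)))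
  have hF' : Continuous fun p : ℂ × ℝ =>
      (circleMap 0 1 p.2)⁻¹ * dirDeriv w f (x + p.1 • w + circleMap 0 1 p.2 • v) :=
    (hinv.comp continuous_snd).mul ((hf.continuous_two_dirDeriv w x w v).comp
      (continuous_fst.prodMk ((continuous_circleMap 0 1).comp continuous_snd)))
  obtain ⟨B, hB⟩ := ((isCompact_closedBall t 1).prod
    (isCompact_Icc (a := (0 : ℝ)) (b := 2 * Real.pi))).exists_bound_of_continuousOn
      hF'.continuousOn
  refine (intervalIntegral.hasDerivAt_integral_of_dominated_loc_of_deriv_le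
    (F := fun s θ => (circleMap 0 1 θ)⁻¹ * f (x + s • w + circleMap 0 1 θ • v))
    (F' := fun s θ => (circleMap 0 1 θ)⁻¹ * dirDeriv w f (x + s • w + circleMap 0 1 θ • v))
    (bound := fun _ => B) (s := Metric.closedBall t 1)
    (Metric.closedBall_mem_nhds t one_pos) ?_ ?_ ?_ ?_ ?_ ?_).2
  · exact Filter.Eventually.of_forall fun s => (hF s).aestronglyMeasurable
  · exact (hF t).intervalIntegrable _ _
  · exact (hF'.comp (continuous_const.prodMk continuous_id :
      Continuous fun θ : ℝ => (t, θ))).aestronglyMeasurable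
  · refine Filter.Eventually.of_forall fun θ hθ s hs => hB (s, θ) ⟨hs, ?_⟩
    rw [Set.uIoc_of_le (by positivity)] at hθ
    exact Set.Ioc_subset_Icc_self hθ
  · exact intervalIntegrable_const
  · refine Filter.Eventually.of_forall fun θ _ s _ => HasDerivAt.const_mul _ ?_
    have h := hf.hasDerivAt_line (x + circleMap 0 1 θ • v) w s
    convert! h using 2
    · congr 1; abel
    · abel

theorem dirDeriv (v : V) : FinitelyEntire (dirDeriv v f) where
  continuous := hf.continuous_dirDeriv v
  differentiable x w t := (hf.hasDerivAt_dirDeriv v x w t).differentiableAt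

theorem dirDeriv_comm (v w : V) :
    _root_.dirDeriv v (_root_.dirDeriv w f) = _root_.dirDeriv w (_root_.dirDeriv v f) := by
  funext x
  rw [(hf.dirDeriv w).dirDeriv_eq_integral, _root_.dirDeriv,
    (hf.hasDerivAt_dirDeriv v x w 0).deriv]
  simp

theorem dirDeriv_smul (c : ℂ) (v : V) (x : V) :
    _root_.dirDeriv (c • v) f x = c * _root_.dirDeriv v f x := by
  have h := ((hf.hasDerivAt_line x v (0 * c)).scomp 0 ((hasDerivAt_id (0 : ℂ)).mul_const c))
  simp only [id, one_mul, zero_mul, zero_smul, add_zero, smul_eq_mul] at h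
  rw [_root_.dirDeriv, ← h.deriv]
  congr 1
  funext t
  simp [mul_smul]

/-- The step `t(v + w)` is split into `tw` followed by `tv`. By the mean value inequality the second
increment is `t` times the derivative along `v` at `x`, up to `o(t)`, because that derivative is
continuous on the plane through `x` spanned by `v` and `w`. -/
theorem dirDeriv_add (v w : V) (x : V) :
    _root_.dirDeriv (v + w) f x = _root_.dirDeriv v f x + _root_.dirDeriv w f x := by
  have hw := hf.hasDerivAt_line x w 0
  rw [zero_smul, add_zero] at hw
  suffices hv : HasDerivAt (fun t : ℂ => f (x + t • v + t • w) - f (x + t • w))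
      (_root_.dirDeriv v f x) 0 by
    have h := (hv.add hw).deriv
    rw [← h, _root_.dirDeriv]
    congr 1
    funext t
    simp [smul_add, add_assoc]
  rw [hasDerivAt_iff_isLittleO_nhds_zero, Asymptotics.isLittleO_iff]
  intro ε hε
  have hc := (hf.continuous_two_dirDeriv v x v w).tendsto (0, 0)
  rw [Metric.tendsto_nhds_nhds] at hc
  obtain ⟨δ, hδ, hc⟩ := hc ε hε
  filter_upwards [Metric.ball_mem_nhds (0 : ℂ) hδ] with t ht
  rw [mem_ball_zero_iff] at ht
  have key := (convex_closedBall (0 : ℂ) ‖t‖).norm_image_sub_le_of_norm_hasDerivWithin_le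
    (f := fun s : ℂ => f (x + t • w + s • v) - s * _root_.dirDeriv v f x)
    (f' := fun s => _root_.dirDeriv v f (x + t • w + s • v) - _root_.dirDeriv v f x)
    (C := ε) (x := 0) (y := t)
    (fun s _ => ((hf.hasDerivAt_line (x + t • w) v s).fun_sub (g' := _root_.dirDeriv v f x)
      (hasDerivAt_mul_const _)).hasDerivWithinAt)
    (fun s hs => by
      rw [mem_closedBall_zero_iff] at hs
      have h := (hc (x := (s, t)) (by
        simp only [Prod.dist_eq, dist_zero_right]
        exact max_lt (hs.trans_lt ht) ht)).le
      simp only [dist_eq_norm, zero_smul, add_zero] at h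
      rwa [add_right_comm])
    (by simp) (by simp)
  simp only [zero_smul, add_zero, zero_mul, sub_zero, smul_eq_mul, zero_add] at key ⊢
  refine le_of_eq_of_le (congrArg _ ?_) key
  rw [add_right_comm]
  ring

theorem dirDeriv_sum {ι : Type*} (s : Finset ι) (c : ι → ℂ) (v : ι → V) (x : V) :
    _root_.dirDeriv (∑ i ∈ s, c i • v i) f x = ∑ i ∈ s, c i * _root_.dirDeriv (v i) f x := by
  classical
  induction s using Finset.induction_on with
  | empty => simp [_root_.dirDeriv]
  | insert a s ha ih =>
    rw [Finset.sum_insert ha, Finset.sum_insert ha, hf.dirDeriv_add, hf.dirDeriv_smul, ih]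

omit hf in
theorem dirDeriv_finset_sum {ι : Type*} (s : Finset ι) (c : ι → ℂ) {g : ι → V → ℂ}
    (hg : ∀ i, FinitelyEntire (g i)) (v : V) (x : V) :
    _root_.dirDeriv v (fun y => ∑ i ∈ s, c i * g i y) x
      = ∑ i ∈ s, c i * _root_.dirDeriv v (g i) x := by
  refine HasDerivAt.deriv (HasDerivAt.fun_sum fun i _ => HasDerivAt.const_mul _ ?_)
  simpa using (hg i).hasDerivAt_line x v 0

theorem norm_dirDeriv_le (v x : V) {ρ M : ℝ} (hρ : 0 < ρ)
    (h : ∀ z : ℂ, ‖z‖ = ρ → ‖f (x + z • v)‖ ≤ M) : ‖_root_.dirDeriv v f x‖ ≤ M / ρ :=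
  Complex.norm_deriv_le_of_forall_mem_sphere_norm_le hρ (hf.differentiable x v).diffContOnCl
    fun z hz => h z (by simpa using hz)

end FinitelyEntire

/-! ### Iterated derivatives: symmetry, Cauchy estimates, Taylor series on lines. -/

/-- The iterated derivative of `f` in the directions of a list of vectors. -/
def iterDirDeriv (l : List V) (f : V → ℂ) : V → ℂ := l.foldr dirDeriv f

namespace FinitelyEntire

variable {f : V → ℂ}

theorem iterDirDeriv (hf : FinitelyEntire f) (l : List V) :
    FinitelyEntire (iterDirDeriv l f) := by
  induction l with
  | nil => exact hf
  | cons v l ih => exact ih.dirDeriv v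

theorem iterDirDeriv_perm (hf : FinitelyEntire f) {l l' : List V} (h : l.Perm l') :
    _root_.iterDirDeriv l f = _root_.iterDirDeriv l' f := by
  induction h with
  | nil => rfl
  | cons v _ ih => exact congrArg (_root_.dirDeriv v) ih
  | swap v w l => exact (hf.iterDirDeriv l).dirDeriv_comm w v
  | trans _ _ ih₁ ih₂ => exact ih₁.trans ih₂

/-- Cauchy's estimate for mixed derivatives. -/
theorem norm_iterDirDeriv_le (hf : FinitelyEntire f) {n : ℕ} (v : Fin n → V) (x : V)
    (ρ : Fin n → ℝ) (hρ : ∀ a, 0 < ρ a) {M : ℝ}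
    (h : ∀ z : Fin n → ℂ, (∀ a, ‖z a‖ = ρ a) → ‖f (x + ∑ a, z a • v a)‖ ≤ M) :
    ‖_root_.iterDirDeriv (List.ofFn v) f x‖ ≤ M / ∏ a, ρ a := by
  induction n generalizing x with
  | zero => simpa [_root_.iterDirDeriv] using h Fin.elim0 (fun a => a.elim0)
  | succ n ih =>
    rw [List.ofFn_succ, Fin.prod_univ_succ, mul_comm, ← div_div]
    refine (hf.iterDirDeriv (List.ofFn fun i : Fin n => v i.succ)).norm_dirDeriv_le _ _ (hρ 0)
      fun z₀ hz₀ => ih _ _ _ (fun a => hρ a.succ) fun z hz => ?_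
    have h1 := h (Fin.cons z₀ z) (fun a => by
      refine Fin.cases ?_ (fun b => ?_) a
      · simpa using hz₀
      · simpa using hz b)
    simpa [Fin.sum_univ_succ, add_assoc] using h1

/-- Multilinear expansion of an iterated derivative in one direction. -/
theorem iterDirDeriv_replicate_sum (hf : FinitelyEntire f) {N : ℕ} (c : Fin N → ℂ)
    (v : Fin N → V) (n : ℕ) (x : V) :
    _root_.iterDirDeriv (List.replicate n (∑ i, c i • v i)) f x
      = ∑ j : Fin n → Fin N, (∏ a, c (j a)) *
          _root_.iterDirDeriv (List.ofFn fun a => v (j a)) f x := by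
  induction n generalizing x with
  | zero => simp
  | succ n ih =>
    rw [List.replicate_succ]
    change _root_.dirDeriv _ (_root_.iterDirDeriv _ f) x = _
    rw [funext ih, dirDeriv_finset_sum _ _ fun j => hf.iterDirDeriv _,
      ← (Fin.consEquiv fun _ : Fin (n + 1) => Fin N).sum_comp, Fintype.sum_prod_type_right]
    refine Finset.sum_congr rfl fun j _ => ?_
    rw [(hf.iterDirDeriv _).dirDeriv_sum, Finset.mul_sum]
    refine Finset.sum_congr rfl fun i _ => ?_
    simp only [Fin.consEquiv_apply, Fin.prod_univ_succ, Fin.cons_zero, Fin.cons_succ,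
      List.ofFn_succ]
    rw [_root_.iterDirDeriv, _root_.iterDirDeriv, List.foldr_cons]
    ring

theorem iteratedDeriv_line (f : V → ℂ) (x v : V) (n : ℕ) :
    iteratedDeriv n (fun t : ℂ => f (x + t • v))
      = fun t => _root_.iterDirDeriv (List.replicate n v) f (x + t • v) := by
  induction n with
  | zero => simp [_root_.iterDirDeriv]
  | succ n ih =>
    rw [iteratedDeriv_succ, ih]
    funext t
    rw [deriv_line_eq_dirDeriv]
    rfl

theorem hasSum_taylor (hf : FinitelyEntire f) (x v : V) :
    HasSum (fun n : ℕ => (n.factorial : ℂ)⁻¹ *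
      _root_.iterDirDeriv (List.replicate n v) f x) (f (x + v)) := by
  simpa [iteratedDeriv_line] using
    Complex.hasSum_taylorSeries_of_entire (hf.differentiable x v) 0 1

end FinitelyEntire

end

end

/-! ### The test space, coordinates of dual elements, and polydiscs. -/

noncomputable section

namespace WhiteNoise

open Filter Topology

variable {H : Type*} [NormedAddCommGroup H] [InnerProductSpace ℝ H] (D : GelfandData H)

/-- The coordinate `⟨e_j, f⟩` of a test vector. -/
def coord (f : TestSpace D) (j : ℕ) : ℝ := D.basis.repr f.1 j

theorem coord_add (f g : TestSpace D) (j : ℕ) : coord D (f + g) j = coord D f j + coord D g j := by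
  change D.basis.repr (f.1 + g.1) j = _
  rw [map_add]; rfl

theorem coord_smul (c : ℝ) (f : TestSpace D) (j : ℕ) : coord D (c • f) j = c * coord D f j := by
  change D.basis.repr (c • f.1) j = _
  rw [map_smul]; rfl

theorem coord_basisVec (i j : ℕ) : coord D (basisVec D i) j = if j = i then 1 else 0 := by
  change D.basis.repr (D.basis i) j = _
  rw [D.basis.repr_self]
  by_cases h : j = i
  · subst h; simp
  · simp [h]

theorem repr_opPow (p : ℝ≥0) (f : TestSpace D) (j : ℕ) :
    D.basis.repr (opPow D p f) j = D.eig j ^ (p : ℝ) * coord D f j := by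
  simp [opPow, coord]

theorem opPow_basisVec (p : ℝ≥0) (j : ℕ) :
    opPow D p (basisVec D j) = D.eig j ^ (p : ℝ) • D.basis j := by
  apply D.basis.repr.injective
  ext i
  rw [repr_opPow, coord_basisVec, map_smul, D.basis.repr_self]
  by_cases h : i = j
  · subst h; simp
  · simp [lp.coeFn_single, h]

theorem norm_opPow_basisVec (p : ℝ≥0) (j : ℕ) :
    ‖opPow D p (basisVec D j)‖ = D.eig j ^ (p : ℝ) := by
  rw [opPow_basisVec, norm_smul, D.basis.orthonormal.1 j, mul_one,
    Real.norm_of_nonneg (Real.rpow_nonneg (D.eig_pos j).le _)]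

theorem abs_coord_le (p : ℝ≥0) (f : TestSpace D) (j : ℕ) :
    |coord D f j| ≤ D.eig j ^ (-(p : ℝ)) * ‖opPow D p f‖ := by
  have h : ‖D.basis.repr (opPow D p f) j‖ ≤ ‖opPow D p f‖ := by
    simpa using lp.norm_apply_le_norm two_ne_zero (D.basis.repr (opPow D p f)) j
  have hpos := Real.rpow_pos_of_pos (D.eig_pos j) (p : ℝ)
  rw [repr_opPow, Real.norm_eq_abs, abs_mul, abs_of_pos hpos] at h
  rw [Real.rpow_neg (D.eig_pos j).le, ← div_eq_inv_mul, le_div_iff₀ hpos, mul_comm]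
  exact h

theorem continuous_opPow (p : ℝ≥0) : Continuous (opPow D p) :=
  continuous_iInf_dom (i := p) continuous_induced_dom

theorem withSeminorms_testSpace :
    WithSeminorms (fun p : ℝ≥0 => (normSeminorm ℝ H).comp (opPow D p)) :=
  (withSeminorms_iInf
    (t := fun p : ℝ≥0 => TopologicalSpace.induced (opPow D p) inferInstance)
    (p := fun p : ℝ≥0 => SeminormFamily.comp (fun _ : Fin 1 => normSeminorm ℝ H) (opPow D p))
    fun p => (opPow D p).withSeminorms_induced (norm_withSeminorms ℝ H)).congr_equiv
      (Equiv.sigmaUnique ℝ≥0 fun _ => Fin 1).symm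

/-- The expansion of a test vector converges in the projective limit topology. -/
theorem hasSum_coord_smul_basisVec (f : TestSpace D) :
    HasSum (fun j => coord D f j • basisVec D j) f := by
  have h : ∀ p : ℝ≥0, HasSum (fun j => opPow D p (coord D f j • basisVec D j)) (opPow D p f) := by
    intro p
    convert! D.basis.hasSum_repr (opPow D p f) using 2 with j
    rw [map_smul, opPow_basisVec, smul_smul, repr_opPow, mul_comm]
  rw [HasSum, nhds_iInf, tendsto_iInf]
  intro p
  rw [nhds_induced, tendsto_comap_iff]
  exact (h p).congr fun s => (map_sum (opPow D p) _ s).symm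

/-- Each term of the convergent series of `λ_j^{-2s}` is at most its sum `T`, so `λ_j ≥
T^{-1/(2s)}`. Since `λ_j ≥ 1` is not assumed, the norms `|·|_p` increase with `p` only up to powers
of this `δ`. -/
theorem exists_pos_le_eig : ∃ δ : ℝ, 0 < δ ∧ ∀ j, δ ≤ D.eig j := by
  obtain ⟨s, hs, hsum⟩ := D.nuclear
  have hT : ∀ j, D.eig j ^ (-(2 * s)) ≤ ∑' i, D.eig i ^ (-(2 * s)) := fun j =>
    hsum.le_tsum j fun i _ => Real.rpow_nonneg (D.eig_pos i).le _
  have hTpos : 0 < ∑' i, D.eig i ^ (-(2 * s)) :=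
    (Real.rpow_pos_of_pos (D.eig_pos 0) _).trans_le (hT 0)
  refine ⟨(∑' i, D.eig i ^ (-(2 * s))) ^ (-(2 * s))⁻¹, Real.rpow_pos_of_pos hTpos _, fun j => ?_⟩
  have h := Real.rpow_le_rpow_of_nonpos (Real.rpow_pos_of_pos (D.eig_pos j) _) (hT j)
    (z := (-(2 * s))⁻¹) (by rw [inv_nonpos]; linarith)
  rwa [Real.rpow_rpow_inv (D.eig_pos j).le (by linarith)] at h

variable {D} in
theorem eig_rpow_le {δ : ℝ} (hδ : 0 < δ) (hle : ∀ j, δ ≤ D.eig j) {p q : ℝ≥0} (hpq : p ≤ q)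
    (j : ℕ) : D.eig j ^ (p : ℝ) ≤ δ ^ ((p : ℝ) - q) * D.eig j ^ (q : ℝ) := by
  have hpq' : (p : ℝ) - q ≤ 0 := sub_nonpos.2 (by exact_mod_cast hpq)
  calc D.eig j ^ (p : ℝ) = D.eig j ^ ((p : ℝ) - q) * D.eig j ^ (q : ℝ) := by
        rw [← Real.rpow_add (D.eig_pos j)]; simp
    _ ≤ _ := mul_le_mul_of_nonneg_right (Real.rpow_le_rpow_of_nonpos hδ (hle j) hpq')
        (Real.rpow_nonneg (D.eig_pos j).le _)

/-- An exponent for which the negative powers of the eigenvalues are summable. -/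
def nuclearExponent : ℝ≥0 := ⟨2 * D.nuclear.choose, by linarith [D.nuclear.choose_spec.1]⟩

theorem summable_eig_rpow_neg : Summable fun j => D.eig j ^ (-(nuclearExponent D : ℝ)) :=
  D.nuclear.choose_spec.2

variable {D}

/-- Every element of the dual has coordinates of polynomial growth in the eigenvalues. -/
theorem DualC.exists_norm_apply_basisVec_le (ξ : DualC D) :
    ∃ (p : ℝ≥0) (C : ℝ), ∀ j, ‖ξ (basisVec D j)‖ ≤ C * D.eig j ^ (p : ℝ) := by
  obtain ⟨δ, hδ, hle⟩ := exists_pos_le_eig D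
  obtain ⟨s, C, -, hC⟩ := Seminorm.bound_of_continuous (withSeminorms_testSpace D)
    ((normSeminorm ℝ ℂ).comp (ξ : TestSpace D →ₗ[ℝ] ℂ)) (continuous_norm.comp ξ.continuous)
  obtain ⟨q, hq⟩ := s.bddAbove
  -- A continuous functional is controlled by finitely many norms; `q` bounds their exponents, and
  -- `δ ^ (p - q)` is the cost of raising `p` to `q`.
  refine ⟨q, C * ∑ p ∈ s, δ ^ ((p : ℝ) - q), fun j => ?_⟩
  have h1 : ‖ξ (basisVec D j)‖ ≤
      C * (s.sup fun p : ℝ≥0 => (normSeminorm ℝ H).comp (opPow D p)) (basisVec D j) :=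
    hC (basisVec D j)
  have h2 : (s.sup fun p : ℝ≥0 => (normSeminorm ℝ H).comp (opPow D p)) (basisVec D j) ≤
      ∑ p ∈ s, D.eig j ^ (p : ℝ) := by
    refine (Seminorm.finset_sup_le_sum _ s _).trans_eq ?_
    rw [sum_apply]
    exact Finset.sum_congr rfl fun p _ => norm_opPow_basisVec D p j
  refine h1.trans ?_
  rw [mul_assoc, Finset.sum_mul]
  exact mul_le_mul_of_nonneg_left (h2.trans (Finset.sum_le_sum fun p hp =>
    eig_rpow_le hδ hle (hq hp) j)) C.2

theorem continuous_of_norm_le_opPow (L : TestSpace D →ₗ[ℝ] ℂ) (p : ℝ≥0) (T : ℝ)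
    (h : ∀ f, ‖L f‖ ≤ T * ‖opPow D p f‖) : Continuous L := by
  refine continuous_of_continuousAt_zero L ?_
  rw [ContinuousAt, map_zero]
  refine squeeze_zero_norm h ?_
  have h1 := ((continuous_opPow D p).norm.const_mul T).tendsto 0
  simpa using h1

variable (D) in
/-- The sequences with `|x_j| ≤ R λ_j^p`. -/
def polydisc (R : ℝ) (p : ℝ≥0) : Set (ℕ → ℂ) :=
  Set.univ.pi fun j => Metric.closedBall 0 (R * D.eig j ^ (p : ℝ))

theorem mem_polydisc {R : ℝ} {p : ℝ≥0} {x : ℕ → ℂ} :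
    x ∈ polydisc D R p ↔ ∀ j, ‖x j‖ ≤ R * D.eig j ^ (p : ℝ) := by
  simp [polydisc]

/-- Stated for every radius beyond `R'`, so that two polydiscs can be put into one by taking maxima.
-/
theorem exists_polydisc_subset {R : ℝ} {p q : ℝ≥0} (hpq : p ≤ q) :
    ∃ R', ∀ S, R' ≤ S → polydisc D R p ⊆ polydisc D S q := by
  obtain ⟨δ, hδ, hle⟩ := exists_pos_le_eig D
  refine ⟨R * δ ^ ((p : ℝ) - q), fun S hS x hx => ?_⟩
  rw [mem_polydisc] at hx ⊢
  have hR : 0 ≤ R := nonneg_of_mul_nonneg_left ((norm_nonneg _).trans (hx 0))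
    (Real.rpow_pos_of_pos (D.eig_pos 0) _)
  intro j
  refine (hx j).trans ((mul_le_mul_of_nonneg_left (eig_rpow_le hδ hle hpq j) hR).trans ?_)
  rw [← mul_assoc]
  exact mul_le_mul_of_nonneg_right hS (Real.rpow_nonneg (D.eig_pos j).le _)

/-- The coordinates of two elements of the dual lie in a common polydisc. -/
theorem exists_mem_polydisc (ξ η : DualC D) :
    ∃ (R : ℝ) (p : ℝ≥0), (fun i => ξ (basisVec D i)) ∈ polydisc D R p ∧
      (fun i => η (basisVec D i)) ∈ polydisc D R p := by
  obtain ⟨p₁, C₁, h₁⟩ := DualC.exists_norm_apply_basisVec_le ξ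
  obtain ⟨p₂, C₂, h₂⟩ := DualC.exists_norm_apply_basisVec_le η
  obtain ⟨R₁, hR₁⟩ := exists_polydisc_subset (D := D) (R := C₁) (le_max_left p₁ p₂)
  obtain ⟨R₂, hR₂⟩ := exists_polydisc_subset (D := D) (R := C₂) (le_max_right p₁ p₂)
  exact ⟨max R₁ R₂, max p₁ p₂, hR₁ _ (le_max_left _ _) (mem_polydisc.2 h₁),
    hR₂ _ (le_max_right _ _) (mem_polydisc.2 h₂)⟩

theorem isCompact_polydisc (R : ℝ) (p : ℝ≥0) : IsCompact (polydisc D R p) :=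
  isCompact_univ_pi fun _ => isCompact_closedBall _ _

/-- Measuring `f` with `nuclearExponent D` more powers of `A` leaves a factor that is summable in
`j`. This is how nuclearity enters. -/
theorem norm_mul_coord_le {R : ℝ} {p : ℝ≥0} {z : ℂ} {j : ℕ} (hz : ‖z‖ ≤ R * D.eig j ^ (p : ℝ))
    (f : TestSpace D) : ‖z * (coord D f j : ℂ)‖ ≤
      R * D.eig j ^ (-(nuclearExponent D : ℝ)) * ‖opPow D (p + nuclearExponent D) f‖ := by
  rw [norm_mul, Complex.norm_real, Real.norm_eq_abs]
  refine (mul_le_mul hz (abs_coord_le D (p + nuclearExponent D) f j) (abs_nonneg _)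
    ((norm_nonneg _).trans hz)).trans_eq ?_
  rw [← mul_assoc, mul_assoc R, ← Real.rpow_add (D.eig_pos j)]
  congr 4
  push_cast; ring

theorem summable_mul_coord {R : ℝ} {p : ℝ≥0} {x : ℕ → ℂ} (hx : x ∈ polydisc D R p)
    (f : TestSpace D) : Summable fun j => x j * (coord D f j : ℂ) :=
  Summable.of_norm_bounded (((summable_eig_rpow_neg D).mul_left R).mul_right _)
    fun j => norm_mul_coord_le (mem_polydisc.1 hx j) f

/-- The element of the dual with given coordinates of polynomial growth. -/
def synthesis {R : ℝ} {p : ℝ≥0} (x : polydisc D R p) : DualC D :=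
  let L : TestSpace D →ₗ[ℝ] ℂ :=
    { toFun := fun f => ∑' j, x.1 j * (coord D f j : ℂ)
      map_add' := fun f g => by
        rw [← (summable_mul_coord x.2 f).tsum_add (summable_mul_coord x.2 g)]
        simp only [coord_add, Complex.ofReal_add, mul_add]
      map_smul' := fun c f => by
        rw [RingHom.id_apply, Complex.real_smul, ← tsum_mul_left]
        simp only [coord_smul, Complex.ofReal_mul, mul_left_comm] }
  ⟨L, continuous_of_norm_le_opPow L (p + nuclearExponent D)
    (∑' j, R * D.eig j ^ (-(nuclearExponent D : ℝ))) fun f => by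
      rw [← tsum_mul_right]
      exact tsum_of_norm_bounded
        (((summable_eig_rpow_neg D).mul_left R).mul_right _).hasSum
        fun j => norm_mul_coord_le (mem_polydisc.1 x.2 j) f⟩

theorem synthesis_apply {R : ℝ} {p : ℝ≥0} (x : polydisc D R p) (f : TestSpace D) :
    synthesis x f = ∑' j, x.1 j * (coord D f j : ℂ) := rfl

theorem synthesis_coord (ξ : DualC D) {R : ℝ} {p : ℝ≥0}
    (hξ : (fun j => ξ (basisVec D j)) ∈ polydisc D R p) : synthesis ⟨_, hξ⟩ = ξ := by
  ext f
  rw [synthesis_apply, ← ((hasSum_coord_smul_basisVec D f).mapL ξ).tsum_eq]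
  refine tsum_congr fun j => ?_
  rw [map_smul, Complex.real_smul, mul_comm]

/-- Synthesis is continuous from the product topology to the strong topology of the dual. -/
theorem continuous_synthesis (R : ℝ) (p : ℝ≥0) :
    Continuous (synthesis : polydisc D R p → DualC D) := by
  rw [continuous_iff_continuousAt]
  intro x₀
  rw [ContinuousAt, ← tendsto_sub_nhds_zero_iff,
    (ContinuousLinearMap.hasBasis_nhds_zero_of_basis Metric.nhds_basis_ball).tendsto_right_iff]
  rintro ⟨B, ε⟩ ⟨hB, hε⟩
  have hB' := hB.image (⟨opPow D (p + nuclearExponent D), continuous_opPow D _⟩ :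
    TestSpace D →L[ℝ] H)
  rw [NormedSpace.isVonNBounded_iff] at hB'
  obtain ⟨C, hC0, hC⟩ := hB'.exists_pos_norm_le
  -- `w j` bounds the `j`-th coordinate uniformly over `B`. Hence `∑ ‖x j - x₀ j‖ w j` bounds the
  -- difference of the functionals on all of `B`; it is continuous in `x` by a summable majorant and
  -- vanishes at `x₀`.
  let w : ℕ → ℝ := fun j => D.eig j ^ (-((p + nuclearExponent D : ℝ≥0) : ℝ)) * C
  have hw : ∀ j, 0 ≤ w j := fun j =>
    mul_nonneg (Real.rpow_nonneg (D.eig_pos j).le _) hC0.le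
  have hbd : ∀ (j : ℕ) (x : polydisc D R p), ‖‖x.1 j - x₀.1 j‖ * w j‖ ≤
      2 * R * D.eig j ^ (-(nuclearExponent D : ℝ)) * C := by
    intro j x
    rw [Real.norm_of_nonneg (mul_nonneg (norm_nonneg _) (hw j))]
    have h1 : ‖x.1 j - x₀.1 j‖ ≤ 2 * (R * D.eig j ^ (p : ℝ)) :=
      (norm_sub_le _ _).trans (by
        linarith [mem_polydisc.1 x.2 j, mem_polydisc.1 x₀.2 j])
    refine (mul_le_mul_of_nonneg_right h1 (hw j)).trans_eq ?_
    have h2 : D.eig j ^ (-(nuclearExponent D : ℝ)) = D.eig j ^ (p : ℝ) *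
        D.eig j ^ (-((p + nuclearExponent D : ℝ≥0) : ℝ)) := by
      rw [← Real.rpow_add (D.eig_pos j)]
      congr 1; push_cast; ring
    rw [h2]; ring
  have hsum : Summable fun j => 2 * R * D.eig j ^ (-(nuclearExponent D : ℝ)) * C :=
    ((summable_eig_rpow_neg D).mul_left _).mul_right _
  have hg : Continuous fun x : polydisc D R p => ∑' j, ‖x.1 j - x₀.1 j‖ * w j :=
    continuous_tsum (fun j => ((((continuous_apply j).comp continuous_subtype_val).sub
      continuous_const).norm).mul continuous_const) hsum hbd
  have h0 := hg.tendsto x₀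
  simp only [sub_self, norm_zero, zero_mul, tsum_zero] at h0
  filter_upwards [h0.eventually_lt_const hε] with x hx f hf
  rw [mem_ball_zero_iff]
  refine lt_of_le_of_lt ?_ hx
  rw [sub_apply, synthesis_apply, synthesis_apply,
    ← (summable_mul_coord x.2 f).tsum_sub (summable_mul_coord x₀.2 f)]
  refine tsum_of_norm_bounded (hsum.of_norm_bounded fun j => hbd j x).hasSum fun j => ?_
  rw [← sub_mul, norm_mul, Complex.norm_real, Real.norm_eq_abs]
  refine mul_le_mul_of_nonneg_left ((abs_coord_le D (p + nuclearExponent D) f j).trans ?_)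
    (norm_nonneg _)
  exact mul_le_mul_of_nonneg_left (hC _ (Set.mem_image_of_mem _ hf))
    (Real.rpow_nonneg (D.eig_pos j).le _)

variable (D) in
/-- The coordinate functional `f ↦ ⟨e_j, f⟩`. -/
def dualBasis (j : ℕ) : DualC D :=
  let L : TestSpace D →ₗ[ℝ] ℂ :=
    { toFun := fun f => (coord D f j : ℂ)
      map_add' := fun f g => by rw [coord_add, Complex.ofReal_add]
      map_smul' := fun c f => by
        rw [RingHom.id_apply, Complex.real_smul, coord_smul, Complex.ofReal_mul] }
  ⟨L, continuous_of_norm_le_opPow L 0 1 fun f => by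
      have h := abs_coord_le D 0 f j
      simp only [NNReal.coe_zero, neg_zero, Real.rpow_zero] at h
      change ‖(coord D f j : ℂ)‖ ≤ _
      rwa [Complex.norm_real]⟩

variable (D) in
/-- The finite combinations of the coordinate functionals. -/
def ofFinsupp : (ℕ →₀ ℂ) →ₗ[ℂ] DualC D := Finsupp.linearCombination ℂ (dualBasis D)

theorem ofFinsupp_apply (x : ℕ →₀ ℂ) (f : TestSpace D) :
    ofFinsupp D x f = ∑ j ∈ x.support, x j * (coord D f j : ℂ) := by
  rw [ofFinsupp, Finsupp.linearCombination_apply, Finsupp.sum, sum_apply]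
  rfl

theorem ofFinsupp_apply_basisVec (x : ℕ →₀ ℂ) (i : ℕ) : ofFinsupp D x (basisVec D i) = x i := by
  rw [ofFinsupp_apply]
  simp only [coord_basisVec]
  rw [Finset.sum_eq_single i]
  · simp
  · intro j _ hj; simp [hj]
  · intro hi; simp [Finsupp.notMem_support_iff.1 hi]

theorem synthesis_finsupp {R : ℝ} {p : ℝ≥0} (x : ℕ →₀ ℂ) (hx : ⇑x ∈ polydisc D R p) :
    synthesis ⟨x, hx⟩ = ofFinsupp D x := by
  ext f
  rw [synthesis_apply, ofFinsupp_apply]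
  exact tsum_eq_sum fun j hj => by simp [Finsupp.notMem_support_iff.1 hj]

/-! ### Restriction of entire functions to finite sequences, and truncation. -/

/-- The restriction of a function on `E'_c × E'_c` to the finite sequences. -/
def restrict (F : DualC D × DualC D → ℂ) (x : (ℕ →₀ ℂ) × (ℕ →₀ ℂ)) : ℂ :=
  F (ofFinsupp D x.1, ofFinsupp D x.2)

theorem continuous_complex_smul (ξ : DualC D × DualC D) :
    Continuous fun z : ℂ => z • ξ :=
  LinearMap.continuous_of_finiteDimensional
    (((LinearMap.toSpanSingleton ℂ (DualC D × DualC D) ξ).restrictScalars ℝ))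

theorem IsEntire.finitelyEntire_restrict {F : DualC D × DualC D → ℂ} (hF : IsEntire F) :
    FinitelyEntire (restrict F) := by
  have h : restrict F = F ∘ (ofFinsupp D).prodMap (ofFinsupp D) := rfl
  rw [h]
  constructor
  · intro n x v
    refine hF.1.comp ?_
    simp only [map_add, map_sum, map_smul]
    exact continuous_const.add (continuous_finsetSum _ fun i _ =>
      (continuous_complex_smul _).comp (continuous_apply i))
  · intro x v
    simpa only [Function.comp_def, map_add, map_smul] using hF.2 _ _

/-- An entire function is bounded on polydiscs. -/
theorem IsEntire.exists_bound_restrict {F : DualC D × DualC D → ℂ} (hF : IsEntire F)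
    (R : ℝ) (p : ℝ≥0) : ∃ M : ℝ, ∀ x : (ℕ →₀ ℂ) × (ℕ →₀ ℂ),
      ⇑x.1 ∈ polydisc D R p → ⇑x.2 ∈ polydisc D R p → ‖restrict F x‖ ≤ M := by
  -- Tychonoff: pulled back by `synthesis`, `F` is continuous on a compact space.
  have : CompactSpace (polydisc D R p) := isCompact_iff_compactSpace.1 (isCompact_polydisc R p)
  have hc : Continuous fun x : polydisc D R p × polydisc D R p =>
      F (synthesis x.1, synthesis x.2) :=
    hF.1.comp (((continuous_synthesis R p).comp continuous_fst).prodMk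
      ((continuous_synthesis R p).comp continuous_snd))
  obtain ⟨M, hM⟩ := isCompact_univ.exists_bound_of_continuousOn hc.continuousOn
  refine ⟨M, fun x h1 h2 => ?_⟩
  have h := hM (⟨x.1, h1⟩, ⟨x.2, h2⟩) trivial
  rwa [synthesis_finsupp, synthesis_finsupp] at h

/-- The truncation of a sequence to its first `N` entries. -/
def truncate (x : ℕ → ℂ) (N : ℕ) : ℕ →₀ ℂ := ∑ j : Fin N, x j • Finsupp.single (j : ℕ) 1

theorem truncate_apply (x : ℕ → ℂ) (N i : ℕ) :
    truncate x N i = if i < N then x i else 0 := by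
  rw [truncate, Finsupp.finsetSum_apply]
  simp only [Finsupp.smul_apply, Finsupp.single_apply, smul_eq_mul, mul_ite, mul_one, mul_zero]
  rw [Fin.sum_univ_eq_sum_range (fun j => if j = i then x j else 0) N]
  simp

theorem truncate_mem_polydisc {x : ℕ → ℂ} {R : ℝ} {p : ℝ≥0} (hx : x ∈ polydisc D R p) (N : ℕ) :
    ⇑(truncate x N) ∈ polydisc D R p := by
  rw [mem_polydisc] at hx ⊢
  intro j
  rw [truncate_apply]
  split_ifs
  · exact hx j
  · simpa using (norm_nonneg _).trans (hx j)

/-- All truncations stay in one polydisc, where coordinatewise convergence implies strong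
convergence by `continuous_synthesis`. -/
theorem tendsto_truncate {R : ℝ} {p : ℝ≥0} (ξ : DualC D)
    (hξ : (fun j => ξ (basisVec D j)) ∈ polydisc D R p) :
    Tendsto (fun N => ofFinsupp D (truncate (fun j => ξ (basisVec D j)) N)) atTop (𝓝 ξ) := by
  have h1 : Tendsto (fun N => (⟨_, truncate_mem_polydisc hξ N⟩ : polydisc D R p)) atTop
      (𝓝 ⟨_, hξ⟩) := by
    rw [tendsto_subtype_rng, tendsto_pi_nhds]
    intro i
    refine tendsto_const_nhds.congr' ?_
    filter_upwards [eventually_gt_atTop i] with N hN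
    simp [truncate_apply, hN]
  have h2 := ((continuous_synthesis R p).tendsto _).comp h1
  rw [synthesis_coord] at h2
  exact h2.congr fun N => synthesis_finsupp _ _

end WhiteNoise

end

/-! ### The Taylor series in two sequence variables. -/

noncomputable section

theorem ENNReal.tsum_pi_prod (g : ℕ → ℝ≥0∞) (l : ℕ) :
    ∑' j : Fin l → ℕ, ∏ a, g (j a) = (∑' i, g i) ^ l := by
  induction l with
  | zero => simp
  | succ l ih =>
    rw [← (Fin.consEquiv fun _ : Fin (l + 1) => ℕ).tsum_eq,
      ENNReal.tsum_prod (f := fun i j => ∏ a, g ((Fin.consEquiv fun _ => ℕ) (i, j) a)), pow_succ', ← ih,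
      ← ENNReal.tsum_mul_right]
    refine tsum_congr fun i => ?_
    rw [← ENNReal.tsum_mul_left]
    refine tsum_congr fun j => ?_
    simp [Fin.consEquiv_apply, Fin.prod_univ_succ]

theorem ENNReal.tsum_pi_prod_mul (g h : ℕ → ℝ≥0∞) (l m : ℕ) :
    ∑' jk : (Fin l → ℕ) × (Fin m → ℕ), (∏ a, g (jk.1 a)) * ∏ b, h (jk.2 b)
      = (∑' i, g i) ^ l * (∑' i, h i) ^ m := by
  rw [ENNReal.tsum_prod (f := fun (j : Fin l → ℕ) (k : Fin m → ℕ) =>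
    (∏ a, g (j a)) * ∏ b, h (k b))]
  simp only [ENNReal.tsum_mul_left, ENNReal.tsum_mul_right, ENNReal.tsum_pi_prod]

/-- The pairs of multi-indices of all lengths. -/
abbrev PairIndex : Type := Σ lm : ℕ × ℕ, (Fin lm.1 → ℕ) × (Fin lm.2 → ℕ)

theorem ENNReal.tsum_pairIndex_lt_top {g : ℕ → ℝ≥0∞} (hg : ∑' i, g i < 1) :
    ∑' s : PairIndex, (∏ a, g (s.2.1 a)) * ∏ b, g (s.2.2 b) < ∞ := by
  rw [ENNReal.tsum_sigma']
  simp only [ENNReal.tsum_pi_prod_mul]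
  rw [ENNReal.tsum_prod (f := fun l m => (∑' i, g i) ^ l * (∑' i, g i) ^ m)]
  simp only [ENNReal.tsum_mul_left, ENNReal.tsum_mul_right, ENNReal.tsum_geometric]
  have h : (1 - ∑' i, g i)⁻¹ < ∞ := ENNReal.inv_lt_top.2 (tsub_pos_of_lt hg)
  exact ENNReal.mul_lt_top h h

theorem summable_pairIndex {g : ℕ → ℝ} (hg0 : ∀ i, 0 ≤ g i) (hg : Summable g)
    (hg1 : ∑' i, g i < 1) :
    Summable fun s : PairIndex => (∏ a, g (s.2.1 a)) * ∏ b, g (s.2.2 b) := by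
  have h := ENNReal.tsum_pairIndex_lt_top (g := fun i => ENNReal.ofReal (g i)) (by
    rw [← ENNReal.ofReal_tsum_of_nonneg hg0 hg]
    exact ENNReal.ofReal_lt_one.2 hg1)
  refine (ENNReal.summable_toReal h.ne).congr fun s => ?_
  rw [ENNReal.toReal_mul, ENNReal.toReal_prod, ENNReal.toReal_prod]
  simp only [ENNReal.toReal_ofReal (hg0 _)]

namespace WhiteNoise

open Filter Topology

/-- The coefficient of `e_{j 1} ⊗ ⋯ ⊗ e_{j l} ⊗ e_{k 1} ⊗ ⋯ ⊗ e_{k m}` in the Taylor series at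
the origin of a function of two finite sequences. -/
def taylorCoeff (f : (ℕ →₀ ℂ) × (ℕ →₀ ℂ) → ℂ) {l m : ℕ} (j : Fin l → ℕ) (k : Fin m → ℕ) : ℂ :=
  (l.factorial : ℂ)⁻¹ * (m.factorial : ℂ)⁻¹ *
    iterDirDeriv (List.ofFn fun b => ((0, Finsupp.single (k b) 1) : (ℕ →₀ ℂ) × (ℕ →₀ ℂ)))
      (iterDirDeriv (List.ofFn fun a => ((Finsupp.single (j a) 1, 0) : (ℕ →₀ ℂ) × (ℕ →₀ ℂ))) f) 0

/-- The terms of the Taylor series. -/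
def taylorTerm (f : (ℕ →₀ ℂ) × (ℕ →₀ ℂ) → ℂ) (x y : ℕ → ℂ) (s : PairIndex) : ℂ :=
  taylorCoeff f s.2.1 s.2.2 * (∏ a, x (s.2.1 a)) * ∏ b, y (s.2.2 b)

/-- A single term of the exponential series; the origin of every factor `e` in the estimates. -/
theorem pow_self_div_factorial_le_exp (l : ℕ) : (l : ℝ) ^ l / l.factorial ≤ Real.exp l :=
  Real.pow_div_factorial_le_exp l (Nat.cast_nonneg l) l

theorem prod_div_card {l : ℕ} (w : Fin l → ℝ) :
    ∏ a, w a / (l : ℝ) = (∏ a, w a) / (l : ℝ) ^ l := by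
  rw [Finset.prod_div_distrib]; simp

section

variable {f : (ℕ →₀ ℂ) × (ℕ →₀ ℂ) → ℂ} (hf : FinitelyEntire f)
include hf

theorem taylorCoeff_perm {l m : ℕ} (σ : Equiv.Perm (Fin l)) (τ : Equiv.Perm (Fin m))
    (j : Fin l → ℕ) (k : Fin m → ℕ) : taylorCoeff f (j ∘ σ) (k ∘ τ) = taylorCoeff f j k := by
  have h1 := hf.iterDirDeriv_perm (σ.ofFn_comp_perm fun a =>
    ((Finsupp.single (j a) 1, 0) : (ℕ →₀ ℂ) × (ℕ →₀ ℂ)))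
  have h2 := (hf.iterDirDeriv (List.ofFn fun a =>
    ((Finsupp.single (j a) 1, 0) : (ℕ →₀ ℂ) × (ℕ →₀ ℂ)))).iterDirDeriv_perm
      (τ.ofFn_comp_perm fun b => ((0, Finsupp.single (k b) 1) : (ℕ →₀ ℂ) × (ℕ →₀ ℂ)))
  rw [taylorCoeff, taylorCoeff, ← h2, ← h1]
  rfl

/-- Cauchy's estimate with radii `w/l` and `w/m`, chosen so that the sum of all the displacements
remains controlled by `w`. -/
theorem norm_taylorCoeff_le {l m : ℕ} (j : Fin l → ℕ) (k : Fin m → ℕ) {w₁ w₂ : ℕ → ℝ}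
    (hw₁ : ∀ i, 0 < w₁ i) (hw₂ : ∀ i, 0 < w₂ i) {M : ℝ}
    (h : ∀ (z : Fin l → ℂ) (z' : Fin m → ℂ), (∀ a, ‖z a‖ = w₁ (j a) / l) →
      (∀ b, ‖z' b‖ = w₂ (k b) / m) →
      ‖f (∑ a, z a • Finsupp.single (j a) 1, ∑ b, z' b • Finsupp.single (k b) 1)‖ ≤ M) :
    ‖taylorCoeff f j k‖ ≤
      Real.exp l * Real.exp m * M / ((∏ a, w₁ (j a)) * ∏ b, w₂ (k b)) := by
  -- An index `a : Fin n` forces `n > 0`, so division by zero never matters.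
  have hpos : ∀ {n : ℕ} (w : ℕ → ℝ) (i : Fin n → ℕ), (∀ i, 0 < w i) → ∀ a, 0 < w (i a) / n :=
    fun w i hw a => div_pos (hw _) (by exact_mod_cast a.pos)
  have h1 := (hf.iterDirDeriv (List.ofFn fun a =>
      ((Finsupp.single (j a) 1, 0) : (ℕ →₀ ℂ) × (ℕ →₀ ℂ)))).norm_iterDirDeriv_le
    (fun b => (0, Finsupp.single (k b) 1)) 0 (fun b => w₂ (k b) / m) (hpos w₂ k hw₂)
    (M := M / ∏ a, w₁ (j a) / (l : ℝ)) fun z' hz' =>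
      hf.norm_iterDirDeriv_le _ _ (fun a => w₁ (j a) / l) (hpos w₁ j hw₁) fun z hz => by
        convert! h z z' hz hz' using 3
        ext <;> simp [Prod.fst_sum, Prod.snd_sum]
  rw [prod_div_card, prod_div_card] at h1
  have hP₁ : 0 < ∏ a, w₁ (j a) := Finset.prod_pos fun a _ => hw₁ _
  have hP₂ : 0 < ∏ b, w₂ (k b) := Finset.prod_pos fun b _ => hw₂ _
  have hM : 0 ≤ M := (norm_nonneg _).trans (h (fun a => ((w₁ (j a) / l : ℝ) : ℂ))
    (fun b => ((w₂ (k b) / m : ℝ) : ℂ))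
    (fun a => by rw [Complex.norm_real, Real.norm_of_nonneg (hpos w₁ j hw₁ a).le])
    (fun b => by rw [Complex.norm_real, Real.norm_of_nonneg (hpos w₂ k hw₂ b).le]))
  rw [taylorCoeff, norm_mul, norm_mul, norm_inv, norm_inv, Complex.norm_natCast,
    Complex.norm_natCast]
  refine (mul_le_mul_of_nonneg_left h1 (by positivity)).trans ?_
  have e : (l.factorial : ℝ)⁻¹ * (m.factorial : ℝ)⁻¹ *
      (M / ((∏ a, w₁ (j a)) / (l : ℝ) ^ l) / ((∏ b, w₂ (k b)) / (m : ℝ) ^ m))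
      = ((l : ℝ) ^ l / l.factorial) * ((m : ℝ) ^ m / m.factorial) *
        (M / ((∏ a, w₁ (j a)) * ∏ b, w₂ (k b))) := by
    simp only [div_eq_mul_inv, mul_inv, inv_inv]; ring
  rw [e, mul_div_assoc]
  refine mul_le_mul_of_nonneg_right ?_ (by positivity)
  exact mul_le_mul (pow_self_div_factorial_le_exp l) (pow_self_div_factorial_le_exp m)
    (by positivity) (by positivity)

theorem hasSum_truncate_fst (x : ℕ → ℂ) (y : ℕ →₀ ℂ) (N : ℕ) :
    HasSum (fun l : ℕ => ∑ j : Fin l → Fin N, (l.factorial : ℂ)⁻¹ * (∏ a, x (j a)) *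
      iterDirDeriv (List.ofFn fun a =>
        ((Finsupp.single ((j a : Fin N) : ℕ) 1, 0) : (ℕ →₀ ℂ) × (ℕ →₀ ℂ))) f (0, y))
      (f (truncate x N, y)) := by
  have h := hf.hasSum_taylor (0, y) (∑ i : Fin N,
    x i • ((Finsupp.single (i : ℕ) 1, 0) : (ℕ →₀ ℂ) × (ℕ →₀ ℂ)))
  simp only [hf.iterDirDeriv_replicate_sum (fun i : Fin N => x i)] at h
  have e : ((0, y) + ∑ i : Fin N, x i • ((Finsupp.single (i : ℕ) 1, 0) :
      (ℕ →₀ ℂ) × (ℕ →₀ ℂ))) = (truncate x N, y) := by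
    ext <;> simp [truncate, Prod.fst_sum, Prod.snd_sum]
  rw [e] at h
  simpa only [Finset.mul_sum, mul_assoc] using h

theorem hasSum_truncate_snd (x : ℕ →₀ ℂ) (y : ℕ → ℂ) (N : ℕ) :
    HasSum (fun m : ℕ => ∑ k : Fin m → Fin N, (m.factorial : ℂ)⁻¹ * (∏ b, y (k b)) *
      iterDirDeriv (List.ofFn fun b =>
        ((0, Finsupp.single ((k b : Fin N) : ℕ) 1) : (ℕ →₀ ℂ) × (ℕ →₀ ℂ))) f (x, 0))
      (f (x, truncate y N)) := by
  have h := hf.hasSum_taylor (x, 0) (∑ i : Fin N,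
    y i • ((0, Finsupp.single (i : ℕ) 1) : (ℕ →₀ ℂ) × (ℕ →₀ ℂ)))
  simp only [hf.iterDirDeriv_replicate_sum (fun i : Fin N => y i)] at h
  have e : ((x, 0) + ∑ i : Fin N, y i • ((0, Finsupp.single (i : ℕ) 1) :
      (ℕ →₀ ℂ) × (ℕ →₀ ℂ))) = (x, truncate y N) := by
    ext <;> simp [truncate, Prod.fst_sum, Prod.snd_sum]
  rw [e] at h
  simpa only [Finset.mul_sum, mul_assoc] using h

omit hf in
theorem tsum_taylorTerm_truncate (x y : ℕ → ℂ) (N l m : ℕ) :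
    ∑' jk : (Fin l → ℕ) × (Fin m → ℕ),
        taylorTerm f (truncate x N) (truncate y N) ⟨(l, m), jk⟩
      = ∑ jk : (Fin l → Fin N) × (Fin m → Fin N),
          taylorTerm f x y ⟨(l, m), (fun a => jk.1 a, fun b => jk.2 b)⟩ := by
  have hinj : Function.Injective fun jk : (Fin l → Fin N) × (Fin m → Fin N) =>
      ((fun a => (jk.1 a : ℕ), fun b => (jk.2 b : ℕ)) : (Fin l → ℕ) × (Fin m → ℕ)) := by
    rintro ⟨j, k⟩ ⟨j', k'⟩ h
    simp only [Prod.mk.injEq, funext_iff, Fin.val_inj] at h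
    exact Prod.ext (funext h.1) (funext h.2)
  rw [← hinj.tsum_eq, tsum_fintype]
  · refine Finset.sum_congr rfl fun jk _ => ?_
    simp [taylorTerm, truncate_apply]
  · intro jk hjk
    rw [Function.mem_support, taylorTerm] at hjk
    have h1 := right_ne_zero_of_mul (left_ne_zero_of_mul hjk)
    have h2 := right_ne_zero_of_mul hjk
    rw [Finset.prod_ne_zero_iff] at h1 h2
    have hlt : ∀ (x : ℕ → ℂ) (i : ℕ), truncate x N i ≠ 0 → i < N := by
      intro x i hi
      by_contra hN
      exact hi (by rw [truncate_apply, if_neg hN])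
    exact ⟨(fun a => ⟨jk.1 a, hlt x _ (h1 a (Finset.mem_univ a))⟩,
      fun b => ⟨jk.2 b, hlt y _ (h2 b (Finset.mem_univ b))⟩), rfl⟩

/-- Taylor expansion in the first variable, then of each of its coefficients in the second, gives an
iterated sum. Summability allows it to be identified with the sum over all pairs of multi-indices.
-/
theorem tsum_taylorTerm_truncate_eq (x y : ℕ → ℂ) (N : ℕ)
    (hs : Summable (taylorTerm f (truncate x N) (truncate y N))) :
    ∑' s, taylorTerm f (truncate x N) (truncate y N) s = f (truncate x N, truncate y N) := by
  rw [hs.tsum_sigma]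
  simp only [tsum_taylorTerm_truncate]
  have hs' := hs.sigma
  simp only [tsum_taylorTerm_truncate] at hs'
  rw [hs'.tsum_prod, ← (hasSum_truncate_fst hf x (truncate y N) N).tsum_eq]
  refine tsum_congr fun l => ?_
  have h : ∀ j : Fin l → Fin N, HasSum (fun m => ∑ k : Fin m → Fin N,
      taylorTerm f x y ⟨(l, m), (fun a => j a, fun b => k b)⟩)
      ((l.factorial : ℂ)⁻¹ * (∏ a, x (j a)) * iterDirDeriv (List.ofFn fun a =>
        ((Finsupp.single ((j a : Fin N) : ℕ) 1, 0) : (ℕ →₀ ℂ) × (ℕ →₀ ℂ))) f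
          (0, truncate y N)) := by
    intro j
    refine ((hasSum_truncate_snd (hf.iterDirDeriv _) 0 y N).mul_left _).congr_fun fun m => ?_
    rw [Finset.mul_sum]
    refine Finset.sum_congr rfl fun k _ => ?_
    rw [taylorTerm, taylorCoeff, Prod.mk_zero_zero]
    ring
  rw [← (hasSum_sum fun j _ => h j).tsum_eq]
  exact tsum_congr fun m => Fintype.sum_prod_type _

end

variable {H : Type*} [NormedAddCommGroup H] [InnerProductSpace ℝ H] {D : GelfandData H}

/-- An index may be repeated, but at most `l` times, and each occurrence contributes a fraction
`1/l` of the radius. -/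
theorem sum_smul_single_mem_polydisc {R : ℝ} {p : ℝ≥0} (hR : 0 ≤ R) {l : ℕ} (j : Fin l → ℕ)
    (z : Fin l → ℂ) (hz : ∀ a, ‖z a‖ = R * D.eig (j a) ^ (p : ℝ) / l) :
    ⇑(∑ a, z a • Finsupp.single (j a) (1 : ℂ)) ∈ polydisc D R p := by
  rw [mem_polydisc]
  intro i
  have hpos : 0 ≤ R * D.eig i ^ (p : ℝ) := mul_nonneg hR (Real.rpow_nonneg (D.eig_pos i).le _)
  rw [Finsupp.finsetSum_apply]
  have h : ∀ a, ‖(z a • Finsupp.single (j a) (1 : ℂ)) i‖ ≤ R * D.eig i ^ (p : ℝ) / l := by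
    intro a
    rw [Finsupp.smul_apply, Finsupp.single_apply]
    split_ifs with hi
    · rw [smul_eq_mul, mul_one, hz, hi]
    · simpa using div_nonneg hpos l.cast_nonneg
  refine (norm_sum_le_of_le _ fun a _ => h a).trans ?_
  rw [Finset.sum_const, Finset.card_univ, Fintype.card_fin, nsmul_eq_mul]
  rcases l.eq_zero_or_pos with rfl | hl
  · simpa using hpos
  · rw [mul_div_cancel₀ _ (by positivity)]

/-- Cauchy's estimate on a polydisc. Only `M` depends on `F`, while the radius `R` is free, so the
geometric ratio `e/R` can be made as small as needed. -/
theorem IsEntire.exists_norm_taylorCoeff_le {F : DualC D × DualC D → ℂ} (hF : IsEntire F)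
    {R : ℝ} (hR : 0 < R) (p : ℝ≥0) : ∃ M : ℝ, ∀ (l m : ℕ) (j : Fin l → ℕ) (k : Fin m → ℕ),
      ‖taylorCoeff (restrict F) j k‖ ≤ M *
        ((∏ a, Real.exp 1 / R * D.eig (j a) ^ (-(p : ℝ))) *
          ∏ b, Real.exp 1 / R * D.eig (k b) ^ (-(p : ℝ))) := by
  obtain ⟨M, hM⟩ := hF.exists_bound_restrict R p
  have hw : ∀ i, 0 < R * D.eig i ^ (p : ℝ) := fun i =>
    mul_pos hR (Real.rpow_pos_of_pos (D.eig_pos i) _)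
  refine ⟨M, fun l m j k => ?_⟩
  have h := norm_taylorCoeff_le hF.finitelyEntire_restrict j k hw hw (M := M)
    fun z z' hz hz' => hM _ (sum_smul_single_mem_polydisc hR.le j z hz)
      (sum_smul_single_mem_polydisc hR.le k z' hz')
  refine h.trans_eq ?_
  have e : ∀ (n : ℕ) (i : Fin n → ℕ), ∏ a, Real.exp 1 / R * D.eig (i a) ^ (-(p : ℝ))
      = Real.exp n / ∏ a, R * D.eig (i a) ^ (p : ℝ) := by
    intro n i
    have h1 : Real.exp n = ∏ _a : Fin n, Real.exp 1 := by simp [← Real.exp_nat_mul]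
    rw [h1, ← Finset.prod_div_distrib]
    refine Finset.prod_congr rfl fun a _ => ?_
    rw [Real.rpow_neg (D.eig_pos _).le, div_mul_eq_div_div, div_eq_mul_inv (_ / _)]
  rw [e, e]
  ring

theorem IsEntire.summable_taylorTerm {F : DualC D × DualC D → ℂ} (hF : IsEntire F)
    {R : ℝ} {p : ℝ≥0} {x y : ℕ → ℂ} (hx : x ∈ polydisc D R p) (hy : y ∈ polydisc D R p) :
    Summable fun s => ‖taylorTerm (restrict F) x y s‖ := by
  rw [mem_polydisc] at hx hy
  set T : ℝ := ∑' i, D.eig i ^ (-(nuclearExponent D : ℝ)) with hT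
  have hτ : ∀ i, 0 ≤ D.eig i ^ (-(nuclearExponent D : ℝ)) := fun i =>
    Real.rpow_nonneg (D.eig_pos i).le _
  have hT0 : 0 ≤ T := tsum_nonneg hτ
  have hR : 0 ≤ R := nonneg_of_mul_nonneg_left ((norm_nonneg _).trans (hx 0))
    (Real.rpow_pos_of_pos (D.eig_pos 0) _)
  -- With this radius the geometric ratio `∑ g` below equals `eRT/(eRT + 1) < 1`.
  have hR' : 0 < Real.exp 1 * R * T + 1 := by positivity
  obtain ⟨M, hM⟩ := hF.exists_norm_taylorCoeff_le hR' (p + nuclearExponent D)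
  set R' := Real.exp 1 * R * T + 1 with hR'def
  let g : ℕ → ℝ := fun i => Real.exp 1 * R / R' * D.eig i ^ (-(nuclearExponent D : ℝ))
  have hg0 : ∀ i, 0 ≤ g i := fun i => mul_nonneg (by positivity) (hτ i)
  have hg : Summable g := (summable_eig_rpow_neg D).mul_left _
  have hg1 : ∑' i, g i < 1 := by
    rw [tsum_mul_left, ← hT, div_mul_eq_mul_div, div_lt_one hR']
    linarith
  refine Summable.of_nonneg_of_le (fun _ => norm_nonneg _) (fun s => ?_)
    ((summable_pairIndex hg0 hg hg1).mul_left M)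
  have hgi : ∀ i, g i = Real.exp 1 / R' * D.eig i ^ (-((p + nuclearExponent D : ℝ≥0) : ℝ)) *
      (R * D.eig i ^ (p : ℝ)) := by
    intro i
    have : D.eig i ^ (-(nuclearExponent D : ℝ)) =
        D.eig i ^ (-((p + nuclearExponent D : ℝ≥0) : ℝ)) * D.eig i ^ (p : ℝ) := by
      rw [← Real.rpow_add (D.eig_pos i)]; congr 1; push_cast; ring
    simp only [g]
    rw [this]; ring
  simp only [hgi, Finset.prod_mul_distrib (g := fun a => R * _)]
  rw [taylorTerm, norm_mul, norm_mul, norm_prod, norm_prod]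
  have hpx := Finset.prod_le_prod (s := Finset.univ) (fun a _ => norm_nonneg (x (s.2.1 a)))
    fun a _ => hx (s.2.1 a)
  have hpy := Finset.prod_le_prod (s := Finset.univ) (fun b _ => norm_nonneg (y (s.2.2 b)))
    fun b _ => hy (s.2.2 b)
  have hc := hM _ _ s.2.1 s.2.2
  have hX : 0 ≤ ∏ a, ‖x (s.2.1 a)‖ := Finset.prod_nonneg fun _ _ => norm_nonneg _
  have hY : 0 ≤ ∏ b, ‖y (s.2.2 b)‖ := Finset.prod_nonneg fun _ _ => norm_nonneg _
  refine (mul_le_mul (mul_le_mul hc hpx hX ((norm_nonneg _).trans hc)) hpy hY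
    (mul_nonneg ((norm_nonneg _).trans hc) (hX.trans hpx))).trans_eq ?_
  ring

/-- The Taylor series represents an entire function. -/
theorem IsEntire.hasSum_taylorTerm {F : DualC D × DualC D → ℂ} (hF : IsEntire F)
    (ξ η : DualC D) :
    HasSum (taylorTerm (restrict F) (fun i => ξ (basisVec D i)) fun i => η (basisVec D i))
      (F (ξ, η)) := by
  obtain ⟨R, p, hξ, hη⟩ := exists_mem_polydisc ξ η
  have hs := hF.summable_taylorTerm hξ hη
  have hle : ∀ (z : ℕ → ℂ) (N i : ℕ), ‖truncate z N i‖ ≤ ‖z i‖ := by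
    intro z N i
    rw [truncate_apply]
    split_ifs <;> simp
  -- Truncation only replaces entries by zero, so the terms for `ξ, η` themselves serve as the
  -- majorant.
  have hlim := tendsto_tsum_of_dominated_convergence (𝓕 := atTop)
    (f := fun N => taylorTerm (restrict F) (truncate (fun i => ξ (basisVec D i)) N)
      (truncate (fun i => η (basisVec D i)) N))
    (g := taylorTerm (restrict F) (fun i => ξ (basisVec D i)) fun i => η (basisVec D i))
    hs (fun s => by
      have ht : ∀ (z : ℕ → ℂ) (i : ℕ), Tendsto (fun N => truncate z N i) atTop (𝓝 (z i)) := by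
        intro z i
        refine tendsto_const_nhds.congr' ?_
        filter_upwards [eventually_gt_atTop i] with N hN
        simp [truncate_apply, hN]
      exact ((tendsto_finsetProd _ fun a _ => ht _ _).const_mul _).mul
        (tendsto_finsetProd _ fun b _ => ht _ _))
    (Eventually.of_forall fun N s => by
      simp only [taylorTerm, norm_mul, norm_prod]
      gcongr <;> exact hle _ _ _)
  have heq : ∀ N, ∑' s, taylorTerm (restrict F) (truncate (fun i => ξ (basisVec D i)) N)
      (truncate (fun i => η (basisVec D i)) N) s =
        F (ofFinsupp D (truncate (fun i => ξ (basisVec D i)) N),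
          ofFinsupp D (truncate (fun i => η (basisVec D i)) N)) := fun N =>
    tsum_taylorTerm_truncate_eq hF.finitelyEntire_restrict _ _ N
      (hF.summable_taylorTerm (truncate_mem_polydisc hξ N) (truncate_mem_polydisc hη N)).of_norm
  simp only [heq] at hlim
  have hlim' := (hF.1.tendsto (ξ, η)).comp
    ((tendsto_truncate ξ hξ).prodMk_nhds (tendsto_truncate η hη))
  rw [tendsto_nhds_unique hlim' hlim]
  exact hs.of_norm.hasSum

/-- Weight times bound is a product of factors `λ^{2q} λ^{-2p} = λ^{-2(p-q)}`, one per index, so the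
sum over multi-indices splits into powers of the Hilbert-Schmidt sums. -/
theorem tensorNormSq_le {l m : ℕ} {κ : (Fin l → ℕ) → (Fin m → ℕ) → ℂ} {A p₁ p₂ : ℝ}
    (hA : 0 ≤ A) (h : ∀ j k, ‖κ j k‖ ^ 2 ≤ A *
      ((∏ a, D.eig (j a) ^ (-(2 * p₁))) * ∏ b, D.eig (k b) ^ (-(2 * p₂)))) (q₁ q₂ : ℝ) :
    tensorNormSq D q₁ q₂ κ ≤
      ENNReal.ofReal A * hsNormSq D p₁ q₁ ^ l * hsNormSq D p₂ q₂ ^ m := by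
  rw [mul_assoc, hsNormSq, hsNormSq, ← ENNReal.tsum_pi_prod_mul, ← ENNReal.tsum_mul_left]
  refine ENNReal.tsum_le_tsum fun jk => ?_
  have hn : ∀ (q : ℝ) (i : ℕ), 0 ≤ D.eig i ^ q := fun q i => Real.rpow_nonneg (D.eig_pos i).le q
  rw [← ENNReal.ofReal_prod_of_nonneg fun _ _ => hn _ _,
    ← ENNReal.ofReal_prod_of_nonneg fun _ _ => hn _ _,
    ← ENNReal.ofReal_mul (Finset.prod_nonneg fun _ _ => hn _ _), ← ENNReal.ofReal_mul hA]
  refine ENNReal.ofReal_le_ofReal ?_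
  have e : ∀ (p q : ℝ) (i : ℕ), D.eig i ^ (-(2 * (p - q))) =
      D.eig i ^ (2 * q) * D.eig i ^ (-(2 * p)) := by
    intro p q i
    rw [← Real.rpow_add (D.eig_pos i)]; congr 1; ring
  simp only [e, Finset.prod_mul_distrib]
  refine (mul_le_mul_of_nonneg_left (h jk.1 jk.2) (mul_nonneg
    (Finset.prod_nonneg fun _ _ => hn _ _) (Finset.prod_nonneg fun _ _ => hn _ _))).trans_eq ?_
  ring

end WhiteNoise

end

/-! ### From the growth bound to the kernel estimate. -/

noncomputable section

theorem FinitelyEntire.norm_le_of_norm_le_one {V : Type*} [AddCommGroup V] [Module ℂ V]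
    {f : V → ℂ} (hf : FinitelyEntire f) {x v : V} {M : ℝ}
    (h : ∀ t : ℂ, ‖t‖ = 1 → ‖f (x + t • v)‖ ≤ M) {t : ℂ} (ht : ‖t‖ ≤ 1) :
    ‖f (x + t • v)‖ ≤ M := by
  refine Complex.norm_le_of_forall_mem_frontier_norm_le (U := Metric.ball (0 : ℂ) 1)
    Metric.isBounded_ball (hf.differentiable x v).diffContOnCl (fun z hz => h z ?_) ?_
  · rw [frontier_ball _ one_ne_zero] at hz
    simpa using hz
  · rw [closure_ball _ one_ne_zero]
    simpa using ht

namespace WhiteNoise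

variable {H : Type*} [NormedAddCommGroup H] [InnerProductSpace ℝ H] (D : GelfandData H)

/-- The sequence `(λ_j^{-p} x_j)_j` in `ℓ²`, whose norm is `|x|_{-p}`. -/
def weighted (p : ℝ) : (ℕ →₀ ℂ) →ₗ[ℂ] lp (fun _ : ℕ => ℂ) 2 :=
  Finsupp.linearCombination ℂ fun j => lp.single 2 j ((D.eig j ^ (-p) : ℝ) : ℂ)

theorem norm_weighted_single (p : ℝ) (j : ℕ) :
    ‖weighted D p (Finsupp.single j 1)‖ = D.eig j ^ (-p) := by
  rw [weighted, Finsupp.linearCombination_single, one_smul, lp.norm_single (by norm_num),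
    Complex.norm_real, Real.norm_of_nonneg (Real.rpow_nonneg (D.eig_pos j).le _)]

theorem weighted_apply (p : ℝ) (x : ℕ →₀ ℂ) (i : ℕ) :
    weighted D p x i = ((D.eig i ^ (-p) : ℝ) : ℂ) * x i := by
  induction x using Finsupp.induction_linear with
  | zero => simp
  | add x y hx hy => rw [map_add, lp.coeFn_add, Pi.add_apply, hx, hy, Finsupp.add_apply, mul_add]
  | single j c =>
    rw [weighted, Finsupp.linearCombination_single, lp.coeFn_smul, Pi.smul_apply, lp.coeFn_single,
      smul_eq_mul]
    by_cases h : i = j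
    · subst h; simp [mul_comm]
    · simp [h]

theorem dualNormSq_ofFinsupp (p : ℝ) (x : ℕ →₀ ℂ) :
    dualNormSq D p (ofFinsupp D x) = ENNReal.ofReal (‖weighted D p x‖ ^ 2) := by
  have h := lp.hasSum_norm (p := 2) (by norm_num) (weighted D p x)
  simp only [ENNReal.toReal_ofNat, Real.rpow_ofNat] at h
  rw [← h.tsum_eq, ENNReal.ofReal_tsum_of_nonneg (fun _ => sq_nonneg _) h.summable, dualNormSq]
  refine tsum_congr fun i => ?_
  rw [ofFinsupp_apply_basisVec, weighted_apply, norm_mul, Complex.norm_real,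
    Real.norm_of_nonneg (Real.rpow_nonneg (D.eig_pos i).le _), mul_pow, ← Real.rpow_mul_natCast (D.eig_pos i).le]
  congr 3
  push_cast; ring

theorem exists_norm_weighted_eq (p : ℝ) {r : ℝ} (hr : 0 < r) {x : ℕ →₀ ℂ}
    (hx : ‖weighted D p x‖ ≤ r) :
    ∃ (x' : ℕ →₀ ℂ) (t : ℂ), ‖weighted D p x'‖ = r ∧ ‖t‖ ≤ 1 ∧ x = t • x' := by
  have key : ∀ y : ℕ →₀ ℂ, 0 < ‖weighted D p y‖ →
      ‖weighted D p (((r / ‖weighted D p y‖ : ℝ) : ℂ) • y)‖ = r := by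
    intro y hy
    rw [map_smul, norm_smul, Complex.norm_real, Real.norm_of_nonneg (by positivity),
      div_mul_cancel₀ _ hy.ne']
  by_cases h0 : x = 0
  -- The zero vector has no direction; any point of the sphere works with `t = 0`.
  · refine ⟨_, 0, key (Finsupp.single 0 1) ?_, by simp, by simp [h0]⟩
    rw [norm_weighted_single]
    exact Real.rpow_pos_of_pos (D.eig_pos 0) _
  · have hpos : 0 < ‖weighted D p x‖ := by
      rw [norm_pos_iff]
      obtain ⟨i, hi⟩ := Finsupp.ne_iff.1 h0
      intro hz
      have h1 := weighted_apply D p x i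
      rw [hz] at h1
      rcases mul_eq_zero.1 h1.symm with h2 | h2
      · exact (Real.rpow_pos_of_pos (D.eig_pos i) (-p)).ne' (Complex.ofReal_eq_zero.1 h2)
      · exact hi h2
    refine ⟨_, ((‖weighted D p x‖ / r : ℝ) : ℂ), key x hpos, ?_, ?_⟩
    · rw [Complex.norm_real, Real.norm_of_nonneg (by positivity)]
      exact (div_le_one hr).2 hx
    · rw [smul_smul, ← Complex.ofReal_mul, div_mul_div_cancel₀ hr.ne', div_self hpos.ne',
        Complex.ofReal_one, one_smul]

theorem norm_weighted_sum_le (p : ℝ) {r : ℝ} (hr : 0 ≤ r) {l : ℕ} (j : Fin l → ℕ) (z : Fin l → ℂ)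
    (hz : ∀ a, ‖z a‖ = r * D.eig (j a) ^ p / l) :
    ‖weighted D p (∑ a, z a • Finsupp.single (j a) 1)‖ ≤ r := by
  rw [map_sum]
  have h : ∀ a, ‖weighted D p (z a • Finsupp.single (j a) 1)‖ ≤ r / l := by
    intro a
    rw [map_smul, norm_smul, norm_weighted_single, hz, div_mul_eq_mul_div, mul_assoc,
      ← Real.rpow_add (D.eig_pos _)]
    simp
  refine (norm_sum_le_of_le _ fun a _ => h a).trans ?_
  rw [Finset.sum_const, Finset.card_univ, Fintype.card_fin, nsmul_eq_mul]
  rcases l.eq_zero_or_pos with rfl | hl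
  · simpa using hr
  · rw [mul_div_cancel₀ _ (by positivity)]

variable {D} {F : DualC D × DualC D → ℂ} {u₁ u₂ : ℝ → ℝ} {C K₁ K₂ p₁ p₂ : ℝ}

/-- By the maximum principle the growth bound on spheres carries over to balls. -/
theorem GrowthBound.norm_restrict_le (hG : GrowthBound u₁ u₂ F C K₁ K₂ p₁ p₂) (hF : IsEntire F)
    {r s : ℝ} (hr : 0 < r) (hs : 0 < s) {x y : ℕ →₀ ℂ} (hx : ‖weighted D p₁ x‖ ≤ r)
    (hy : ‖weighted D p₂ y‖ ≤ s) :
    ‖restrict F (x, y)‖ ≤ √(C * u₁ (K₁ * r ^ 2) * u₂ (K₂ * s ^ 2)) := by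
  have hf := hF.finitelyEntire_restrict
  -- Since `u₁` and `u₂` need not be monotone, the growth bound yields this constant directly only
  -- at the exact radii. The interior is reached below by the maximum principle, one variable at a
  -- time.
  have h0 : ∀ x y : ℕ →₀ ℂ, ‖weighted D p₁ x‖ = r → ‖weighted D p₂ y‖ = s →
      ‖restrict F (x, y)‖ ≤ √(C * u₁ (K₁ * r ^ 2) * u₂ (K₂ * s ^ 2)) := by
    intro x y hx hy
    have h := hG (ofFinsupp D x) (ofFinsupp D y)
    rw [dualNormSq_ofFinsupp, dualNormSq_ofFinsupp, hx, hy,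
      ENNReal.toReal_ofReal (sq_nonneg _), ENNReal.toReal_ofReal (sq_nonneg _)] at h
    exact Real.le_sqrt_of_sq_le (h ENNReal.ofReal_lt_top ENNReal.ofReal_lt_top)
  obtain ⟨x', t, hx', ht, rfl⟩ := exists_norm_weighted_eq D p₁ hr hx
  obtain ⟨y', t', hy', ht', rfl⟩ := exists_norm_weighted_eq D p₂ hs hy
  have h1 : ∀ t : ℂ, ‖t‖ = 1 → ∀ t' : ℂ, ‖t'‖ = 1 →
      ‖restrict F (t • x', t' • y')‖ ≤ √(C * u₁ (K₁ * r ^ 2) * u₂ (K₂ * s ^ 2)) :=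
    fun t ht t' ht' => h0 _ _ (by rw [map_smul, norm_smul, ht, one_mul, hx'])
      (by rw [map_smul, norm_smul, ht', one_mul, hy'])
  have h2 : ∀ t : ℂ, ‖t‖ = 1 →
      ‖restrict F (t • x', t' • y')‖ ≤ √(C * u₁ (K₁ * r ^ 2) * u₂ (K₂ * s ^ 2)) := by
    intro t ht
    have h := hf.norm_le_of_norm_le_one (x := (t • x', 0)) (v := (0, y'))
      (fun t' ht' => by simpa using h1 t ht t' ht') ht'
    simpa using h
  have h := hf.norm_le_of_norm_le_one (x := (0, t' • y')) (v := (x', 0))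
    (fun t ht => by simpa using h2 t ht) ht
  simpa using h

theorem prod_const_mul_rpow {l : ℕ} (r p : ℝ) (j : Fin l → ℕ) :
    ∏ a, r * D.eig (j a) ^ p = r ^ l * ∏ a, D.eig (j a) ^ p := by
  rw [Finset.prod_mul_distrib]; simp

theorem prod_rpow_neg_two_mul {l : ℕ} (p : ℝ) (j : Fin l → ℕ) :
    ∏ a, D.eig (j a) ^ (-(2 * p)) = ((∏ a, D.eig (j a) ^ p) ^ 2)⁻¹ := by
  rw [← Finset.prod_pow, ← Finset.prod_inv_distrib]
  refine Finset.prod_congr rfl fun a _ => ?_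
  rw [Real.rpow_neg (D.eig_pos _).le, mul_comm, Real.rpow_mul (D.eig_pos _).le, Real.rpow_two]

theorem GrowthBound.norm_taylorCoeff_sq_le_of_pos (hG : GrowthBound u₁ u₂ F C K₁ K₂ p₁ p₂)
    (hF : IsEntire F) (hu₁ : MemCLog u₁) (hu₂ : MemCLog u₂) (hC : 0 < C) (hK₁ : 0 < K₁)
    (hK₂ : 0 < K₂) {l m : ℕ} (j : Fin l → ℕ) (k : Fin m → ℕ) {ρ₁ ρ₂ : ℝ} (hρ₁ : 0 < ρ₁)
    (hρ₂ : 0 < ρ₂) :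
    ‖taylorCoeff (restrict F) j k‖ ^ 2 ≤
      C * (K₁ * Real.exp 2) ^ l * (K₂ * Real.exp 2) ^ m *
        ((∏ a, D.eig (j a) ^ (-(2 * p₁))) * ∏ b, D.eig (k b) ^ (-(2 * p₂))) *
        (u₁ ρ₁ / ρ₁ ^ (l : ℝ)) * (u₂ ρ₂ / ρ₂ ^ (m : ℝ)) := by
  -- The radius `r` with `K₁ r² = ρ₁`: the argument of `u₁` becomes `ρ₁`, and `r^{-2l}` becomes
  -- `K₁^l / ρ₁^l`.
  have hr : 0 < √(ρ₁ / K₁) := Real.sqrt_pos.2 (div_pos hρ₁ hK₁)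
  have hs : 0 < √(ρ₂ / K₂) := Real.sqrt_pos.2 (div_pos hρ₂ hK₂)
  have h := norm_taylorCoeff_le hF.finitelyEntire_restrict j k
    (w₁ := fun i => √(ρ₁ / K₁) * D.eig i ^ p₁) (w₂ := fun i => √(ρ₂ / K₂) * D.eig i ^ p₂)
    (fun i => mul_pos hr (Real.rpow_pos_of_pos (D.eig_pos i) _))
    (fun i => mul_pos hs (Real.rpow_pos_of_pos (D.eig_pos i) _))
    fun z z' hz hz' => hG.norm_restrict_le hF hr hs
      (norm_weighted_sum_le D p₁ hr.le j z hz) (norm_weighted_sum_le D p₂ hs.le k z' hz')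
  rw [Real.sq_sqrt (div_pos hρ₁ hK₁).le, Real.sq_sqrt (div_pos hρ₂ hK₂).le,
    mul_div_cancel₀ _ hK₁.ne', mul_div_cancel₀ _ hK₂.ne'] at h
  have h2 := pow_le_pow_left₀ (norm_nonneg _) h 2
  refine h2.trans_eq ?_
  have hU := (hu₁.pos ρ₁ hρ₁.le).le
  have hV := (hu₂.pos ρ₂ hρ₂.le).le
  have e2 : ∀ n : ℕ, Real.exp n ^ 2 = Real.exp 2 ^ n := by
    intro n
    rw [← Real.exp_nat_mul, ← Real.exp_nat_mul, mul_comm]; norm_num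
  have e3 : ∀ (ρ K : ℝ) (n : ℕ), 0 < ρ → 0 < K → (√(ρ / K) ^ n) ^ 2 = ρ ^ n / K ^ n := by
    intro ρ K n hρ hK
    rw [← pow_mul, mul_comm, pow_mul, Real.sq_sqrt (div_pos hρ hK).le, div_pow]
  simp only [prod_const_mul_rpow, prod_rpow_neg_two_mul]
  rw [div_pow, mul_pow, mul_pow, Real.sq_sqrt (by positivity), e2, e2, mul_pow, mul_pow, mul_pow,
    e3 _ _ _ hρ₁ hK₁, e3 _ _ _ hρ₂ hK₂, Real.rpow_natCast, Real.rpow_natCast, mul_pow, mul_pow]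
  simp only [div_eq_mul_inv, mul_inv, inv_inv]
  ring

theorem legendre_nonneg {u : ℝ → ℝ} (hu : MemCLog u) (t : ℝ) : 0 ≤ legendre u t :=
  Real.iInf_nonneg fun r => div_nonneg (hu.pos _ r.2.le).le (Real.rpow_nonneg r.2.le _)

theorem le_mul_legendre {u : ℝ → ℝ} {t a c : ℝ} (hc : 0 ≤ c)
    (h : ∀ r, 0 < r → a ≤ c * (u r / r ^ t)) : a ≤ c * legendre u t := by
  have : Nonempty (Set.Ioi (0 : ℝ)) := ⟨⟨1, Set.mem_Ioi.2 one_pos⟩⟩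
  rw [legendre, Real.mul_iInf_of_nonneg hc]
  exact le_ciInf fun r => h r r.2

theorem GrowthBound.norm_taylorCoeff_sq_le (hG : GrowthBound u₁ u₂ F C K₁ K₂ p₁ p₂)
    (hF : IsEntire F) (hu₁ : MemCLog u₁) (hu₂ : MemCLog u₂) (hC : 0 < C) (hK₁ : 0 < K₁)
    (hK₂ : 0 < K₂) {l m : ℕ} (j : Fin l → ℕ) (k : Fin m → ℕ) :
    ‖taylorCoeff (restrict F) j k‖ ^ 2 ≤
      C * (K₁ * Real.exp 2) ^ l * (K₂ * Real.exp 2) ^ m * legendre u₁ l * legendre u₂ m *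
        ((∏ a, D.eig (j a) ^ (-(2 * p₁))) * ∏ b, D.eig (k b) ^ (-(2 * p₂))) := by
  have hW : 0 ≤ C * (K₁ * Real.exp 2) ^ l * (K₂ * Real.exp 2) ^ m *
      ((∏ a, D.eig (j a) ^ (-(2 * p₁))) * ∏ b, D.eig (k b) ^ (-(2 * p₂))) :=
    mul_nonneg (by positivity) (mul_nonneg
      (Finset.prod_nonneg fun _ _ => Real.rpow_nonneg (D.eig_pos _).le _)
      (Finset.prod_nonneg fun _ _ => Real.rpow_nonneg (D.eig_pos _).le _))
  refine (le_mul_legendre (u := u₂) (t := m) (mul_nonneg hW (legendre_nonneg hu₁ l))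
    fun ρ₂ hρ₂ => ?_).trans_eq (by ring)
  rw [mul_right_comm]
  refine le_mul_legendre (mul_nonneg hW
    (div_nonneg (hu₂.pos _ hρ₂.le).le (Real.rpow_nonneg hρ₂.le _))) fun ρ₁ hρ₁ => ?_
  rw [mul_right_comm]
  exact hG.norm_taylorCoeff_sq_le_of_pos hF hu₁ hu₂ hC hK₁ hK₂ j k hρ₁ hρ₂

theorem IsEntire.tensorNormSq_taylorCoeff_lt_top (hF : IsEntire F) (l m : ℕ) {q : ℝ}
    (hq : 0 ≤ q) : tensorNormSq D q q (taylorCoeff (restrict F) (l := l) (m := m)) < ∞ := by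
  -- Then `2(p - q)` is the nuclear exponent, which makes the Hilbert-Schmidt norm finite.
  let p : ℝ≥0 := ⟨q, hq⟩ + nuclearExponent D / 2
  obtain ⟨M, hM⟩ := hF.exists_norm_taylorCoeff_le one_pos p
  have h := tensorNormSq_le (D := D) (κ := taylorCoeff (restrict F) (l := l) (m := m))
    (A := (M * Real.exp 1 ^ l * Real.exp 1 ^ m) ^ 2) (p₁ := p) (p₂ := p) (sq_nonneg _)
    (fun j k => by
      refine (pow_le_pow_left₀ (norm_nonneg _) (hM l m j k) 2).trans_eq ?_
      rw [prod_rpow_neg_two_mul, prod_rpow_neg_two_mul, prod_const_mul_rpow, prod_const_mul_rpow]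
      simp only [div_one, Real.rpow_neg (D.eig_pos _).le, Finset.prod_inv_distrib]
      ring) q q
  refine h.trans_lt ?_
  have hp : -(2 * ((p : ℝ) - q)) = -(nuclearExponent D : ℝ) := by
    have hpq : (p : ℝ) = q + nuclearExponent D / 2 := rfl
    rw [hpq]; ring
  have hs : hsNormSq D p q < ∞ := by
    rw [hsNormSq, hp, ← ENNReal.ofReal_tsum_of_nonneg
      (fun i => Real.rpow_nonneg (D.eig_pos i).le _) (summable_eig_rpow_neg D)]
    exact ENNReal.ofReal_lt_top
  exact ENNReal.mul_lt_top (ENNReal.mul_lt_top ENNReal.ofReal_lt_top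
    (ENNReal.pow_lt_top hs)) (ENNReal.pow_lt_top hs)

/-- The Taylor kernels of an entire function. -/
def IsEntire.kernel (hF : IsEntire F) (l m : ℕ) : TensorKernel D l m where
  coeff := taylorCoeff (restrict F)
  norm_finite _ hq := hF.tensorNormSq_taylorCoeff_lt_top l m hq
  symm := taylorCoeff_perm hF.finitelyEntire_restrict

theorem IsEntire.summable_pairingTerm_kernel (hF : IsEntire F) (ξ η : DualC D) (l m : ℕ) :
    Summable ((hF.kernel l m).pairingTerm ξ η) :=
  (hF.hasSum_taylorTerm ξ η).summable.sigma_factor (l, m)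

/-- The convergent sum over `PairIndex` is grouped by the lengths `(l, m)`; each group is one
pairing. -/
theorem IsEntire.hasSum_pairing_kernel (hF : IsEntire F) (ξ η : DualC D) :
    HasSum (fun lm : ℕ × ℕ => (hF.kernel lm.1 lm.2).pairing ξ η) (F (ξ, η)) :=
  (hF.hasSum_taylorTerm ξ η).sigma fun lm =>
    (hF.summable_pairingTerm_kernel ξ η lm.1 lm.2).hasSum

end WhiteNoise

end

theorem lemma3p2 {H : Type*} [NormedAddCommGroup H] [InnerProductSpace ℝ H] [CompleteSpace H]
    (D : WhiteNoise.GelfandData H) (u₁ u₂ : ℝ → ℝ)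
    (hu₁ : WhiteNoise.MemCLog u₁) (hu₂ : WhiteNoise.MemCLog u₂)
    (F : WhiteNoise.DualC D × WhiteNoise.DualC D → ℂ) (hF : WhiteNoise.IsEntire F) :
    ∃ κ : (l m : ℕ) → WhiteNoise.TensorKernel D l m,
      (∀ ξ η : WhiteNoise.DualC D,
        (∀ l m : ℕ, Summable ((κ l m).pairingTerm ξ η)) ∧
        HasSum (fun lm : ℕ × ℕ => (κ lm.1 lm.2).pairing ξ η) (F (ξ, η))) ∧
      ∀ C K₁ K₂ p₁ p₂ : ℝ, 0 < C → 0 < K₁ → 0 < K₂ → 0 ≤ p₁ → 0 ≤ p₂ →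
        WhiteNoise.GrowthBound u₁ u₂ F C K₁ K₂ p₁ p₂ →
        ∀ q₁ q₂ : ℝ, q₁ < p₁ → q₂ < p₂ →
          ENNReal.ofReal (K₁ * Real.exp 2) * WhiteNoise.hsNormSq D p₁ q₁ < 1 →
          ENNReal.ofReal (K₂ * Real.exp 2) * WhiteNoise.hsNormSq D p₂ q₂ < 1 →
          ∀ l m : ℕ,
            WhiteNoise.tensorNormSq D q₁ q₂ (κ l m).coeff ≤
              ENNReal.ofReal C
                * (ENNReal.ofReal (K₁ * Real.exp 2) * WhiteNoise.hsNormSq D p₁ q₁) ^ l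
                * (ENNReal.ofReal (K₂ * Real.exp 2) * WhiteNoise.hsNormSq D p₂ q₂) ^ m
                * ENNReal.ofReal (WhiteNoise.legendre u₁ l)
                * ENNReal.ofReal (WhiteNoise.legendre u₂ m) := by
  refine ⟨hF.kernel, fun ξ η => ⟨hF.summable_pairingTerm_kernel ξ η,
    hF.hasSum_pairing_kernel ξ η⟩, ?_⟩
  intro C K₁ K₂ p₁ p₂ hC hK₁ hK₂ _ _ hG q₁ q₂ _ _ _ _ l m
  have hL₁ := WhiteNoise.legendre_nonneg hu₁ l
  have hL₂ := WhiteNoise.legendre_nonneg hu₂ m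
  refine (WhiteNoise.tensorNormSq_le (κ := (hF.kernel l m).coeff) (by positivity)
    (hG.norm_taylorCoeff_sq_le hF hu₁ hu₂ hC hK₁ hK₂) q₁ q₂).trans_eq ?_
  rw [ENNReal.ofReal_mul (by positivity), ENNReal.ofReal_mul (by positivity),
    ENNReal.ofReal_mul (by positivity), ENNReal.ofReal_mul hC.le,
    ENNReal.ofReal_pow (by positivity), ENNReal.ofReal_pow (by positivity), mul_pow, mul_pow]
  ring
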